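/- For a convex polytope $P\subset\mathbb R^3$ with nonempty interior, let $\mathrm{Dehn}(P)=\sum_e \ell(e)\otimes\theta(e)\in\mathbb R\otimes_{\mathbb Z}\mathbb R/\pi\mathbb Z$, the sum being over the edges $e$ of $P$, with $\ell(e)$ the length of $e$ and $\theta(e)$ the interior dihedral angle of $P$ along $e$. Let $h>0$ be real, $O=(0,0,0)$, $S=(0,0,h)$, and let $T_1(h)=P_4(h)$ be the right pyramid with apex $S$ whose horizontal base is the square with vertices $A=(1,0,0)$, $B=(0,1,0)$, $A'=(-1,0,0)$, $(0,-1,0)$ (the fourth roots of unity). Put $M=(\tfrac12,\tfrac12,0)$, $M'=(\tfrac12,-\tfrac12,0)$, $N=(-\tfrac12,\tfrac12,0)$ and let $$T_2(h)=\mathrm{conv}(A,B,N,M',S),\quad T_3(h)=\mathrm{conv}(A,B,A',S),\quad T_4(h)=\mathrm{conv}(O,M,A,M',S),$$ $$T_5(h)=\mathrm{conv}(O,A,B,S),\quad T_6(h)=\mathrm{conv}(O,M,A,S).$$ Then: 1. These polytopes arise by successive symmetric cuts: each of $T_2(h)$ and $T_3(h)$ is a half of $T_1(h)$, $T_4(h)$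 is a half of $T_2(h)$, $T_5(h)$ is a half of $T_3(h)$, and $T_6(h)$ is a half of $T_4(h)$ and also a half of $T_5(h)$. Here a half of $P$ means one of the two pieces into which $P$ is cut by a vertical plane containing the line $OS$ that is a plane of symmetry of $P$. 2. For each $i\in\{1,\dots,6\}$, $\mathrm{Dehn}(T_i(h))=0$ if and only if $h=1/\sqrt2$. 3. Call a tetrahedron $v_0v_1v_2v_3$ in $\mathbb R^3$ a Schläfli orthoscheme with lengths $(a,b,c)$ if the edges $v_0v_1$, $v_1v_2$, $v_2v_3$ are mutually perpendicular and have lengths $a,b,c$ respectively. Then $T_6(h)$ is a Schläfli orthoscheme with lengths $(1/\sqrt2,1/\sqrt2,h)$, and for every Schläfli orthoscheme $K$ with lengths $(1/\sqrt2,1/\sqrt2,h)$, $\mathrm{Dehn}(K)=0$ if and only if $h=1/\sqrt2$. -/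

import Mathlib

open scoped TensorProduct

noncomputable section

/-- Euclidean three-space. -/
abbrev E3 : Type := EuclideanSpace ℝ (Fin 3)

/-- `F` is a `d`-dimensional face of the convex polytope `P`: the (nonempty) set of points of `P`
where some linear functional attains its maximum on `P`, of affine dimension `d`. -/
def IsFaceOfDim (P : Set E3) (d : ℕ) (F : Set E3) : Prop :=
  F.Nonempty ∧ IsExposed ℝ P F ∧ Module.finrank ℝ (vectorSpan ℝ F) = d

/-- The edges of a convex polytope. -/
def edges (P : Set E3) : Set (Set E3) := {e | IsFaceOfDim P 1 e}

/-- `θ` is the interior angle between two distinct facets `F`, `G` of `P` meeting along `e`: the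
angle between a vector pointing from the line of `e` into `F` and a vector pointing from the line
of `e` into `G`, both perpendicular to `e`. For a three-dimensional convex polytope `P` and an edge
`e` of `P`, there is exactly one such `θ`. -/
def IsDihedralAngle (P e : Set E3) (θ : ℝ) : Prop :=
  ∃ F G : Set E3, IsFaceOfDim P 2 F ∧ IsFaceOfDim P 2 G ∧ F ≠ G ∧ e ⊆ F ∧ e ⊆ G ∧
    ∃ x ∈ F, ∃ y ∈ G, ∃ p ∈ affineSpan ℝ e, ∃ q ∈ affineSpan ℝ e,
      x ≠ p ∧ y ≠ q ∧ x - p ∈ (vectorSpan ℝ e)ᗮ ∧ y - q ∈ (vectorSpan ℝ e)ᗮ ∧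
      θ = InnerProductGeometry.angle (x - p) (y - q)

/-- The dihedral angle of `P` along the edge `e` (the set below is a singleton). -/
def dihedralAngle (P e : Set E3) : ℝ := sSup {θ | IsDihedralAngle P e θ}

/-- The group `ℝ ⊗ ℝ/πℤ` (tensor product over `ℤ`) in which Dehn invariants live. -/
abbrev DehnGroup : Type := ℝ ⊗[ℤ] AddCircle Real.pi

/-- The Dehn invariant of a three-dimensional convex polytope: the sum over its (finitely many)
edges of `length ⊗ dihedral angle`. -/
def dehn (P : Set E3) : DehnGroup :=
  ∑ᶠ e ∈ edges P, (Metric.diam e) ⊗ₜ[ℤ] ((dihedralAngle P e : ℝ) : AddCircle Real.pi)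

/-- The right pyramid whose horizontal base has the `n`-th roots of unity as vertices, centred at
the origin `O`, and whose apex is `S = (0, 0, h)`. -/
def symmetricPyramid (n : ℕ) (h : ℝ) : Set E3 :=
  convexHull ℝ ({x | ∃ z : ℂ, z ^ n = 1 ∧ x = !₂[z.re, z.im, 0]} ∪ {!₂[0, 0, h]})

/-- `B` is one of the two halves into which `P` is cut by a plane of symmetry of `P` which is
vertical and contains the origin `O` (hence contains the line `OS`). -/
def IsSymmetricCut (P B : Set E3) : Prop :=
  ∃ n : E3, n ≠ 0 ∧ n 2 = 0 ∧ (ℝ ∙ n)ᗮ.reflection '' P = P ∧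
    B = P ∩ {x | 0 ≤ inner ℝ n x}

/-- The square pyramid with base vertices `±1, ±i` and apex `(0, 0, h)`. -/
def T1 (h : ℝ) : Set E3 := symmetricPyramid 4 h

/-- Half of `T1` cut parallel to a side of the base: a pyramid over a rectangle. -/
def T2 (h : ℝ) : Set E3 :=
  convexHull ℝ {!₂[1, 0, 0], !₂[0, 1, 0], !₂[-1/2, 1/2, 0], !₂[1/2, -1/2, 0], !₂[0, 0, h]}

/-- Half of `T1` cut along a diagonal of the base: a tetrahedron. -/
def T3 (h : ℝ) : Set E3 :=
  convexHull ℝ {!₂[1, 0, 0], !₂[0, 1, 0], !₂[-1, 0, 0], !₂[0, 0, h]}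

/-- Half of `T2`: a pyramid over a square, with apex above a vertex of the square. -/
def T4 (h : ℝ) : Set E3 :=
  convexHull ℝ {!₂[0, 0, 0], !₂[1/2, 1/2, 0], !₂[1, 0, 0], !₂[1/2, -1/2, 0], !₂[0, 0, h]}

/-- Half of `T3`: a tetrahedron with three mutually perpendicular edges at `O`. -/
def T5 (h : ℝ) : Set E3 :=
  convexHull ℝ {!₂[0, 0, 0], !₂[1, 0, 0], !₂[0, 1, 0], !₂[0, 0, h]}

/-- Half of `T4`, and also half of `T5`: a tetrahedron. -/
def T6 (h : ℝ) : Set E3 :=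
  convexHull ℝ {!₂[0, 0, 0], !₂[1/2, 1/2, 0], !₂[1, 0, 0], !₂[0, 0, h]}

/-- `v 0, v 1, v 2, v 3` are the vertices of a Schläfli orthoscheme with lengths `(a, b, c)`: the
consecutive edges `v 0 v 1`, `v 1 v 2`, `v 2 v 3` are mutually perpendicular and have lengths
`a, b, c`. -/
def IsSchlafliOrthoscheme (v : Fin 4 → E3) (a b c : ℝ) : Prop :=
  inner ℝ (v 1 - v 0) (v 2 - v 1) = 0 ∧ inner ℝ (v 1 - v 0) (v 3 - v 2) = 0 ∧
    inner ℝ (v 2 - v 1) (v 3 - v 2) = 0 ∧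
    dist (v 0) (v 1) = a ∧ dist (v 1) (v 2) = b ∧ dist (v 2) (v 3) = c

end

/-! Write α for `baseAngle h`, β for `apexAngle h` and c = √(1 + 2h²), so that c cos α = 1 and c cos
β = h. The orthoscheme has dihedral angle π/2 along three edges, π/4 along OS, α along one edge of
length 1/√2 and β along the edge of length √(1 + h²). Rational multiples of π vanish in ℝ ⊗ ℝ/πℤ, so
its Dehn invariant is ω = 1/√2 ⊗ α + √(1 + h²) ⊗ β (`orthoschemeDehn`). The other polytopes only
have angles π/2, α, β and 2β, and their invariants are 2ω, 4ω and 8ω. The group is a real vector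
space, hence torsion-free, so everything reduces to `tmul_baseAngle_add_tmul_apexAngle_eq_zero_iff`:
ω = 0 exactly when h = 1/√2.

For h = 1/√2 the angles are π/4 and π/3. Conversely, suppose ω = 0. Applying ℚ-linear functionals to
the lengths (`rational_angles_or_rational_ratio`) leaves two cases.

If α and β are both rational multiples of π, eliminating h gives 2 cos 2β + cos 2α = -1. Kronecker's
theorem on algebraic integers with all conjugates in the unit disc leaves three values of cos 2β
(`two_cos_add_one_of_rational`), and only -1/2 comes from a positive h, namely 1/√2.

Otherwise the ratio of the lengths is a rational p/q in lowest terms and qα + pβ is a rational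
multiple of π. Exponentiating gives an identity between powers in ℤ[√D] with D = 2q² - p² < 0.
Reducing it modulo a prime divisor of p² - q² forces that prime to be 2 (`eq_two_of_prime_dvd`),
which leaves p/q = 3 and p/q = 5/3. Niven's theorem rules out both.

The geometric side identifies faces of a convex hull with sets of labels of its generators, so that
edges and facets become finite combinatorics; the dihedral angles are then read off from Gram
determinants. -/

noncomputable section

open Set

/-! ### Faces of a convex hull as sets of labels of its generators -/

/-- The face of a convex hull on which a linear functional is maximal is spanned by the generators
lying on it. -/
theorem convexHull_inter_eq_max {s : Set E3} (l : E3 →L[ℝ] ℝ) {M : ℝ} (hM : ∀ x ∈ s, l x ≤ M) :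
    {x ∈ convexHull ℝ s | l x = M} = convexHull ℝ {x ∈ s | l x = M} := by
  apply Subset.antisymm
  · have hle : convexHull ℝ s ⊆ {x | l x ≤ M} :=
      convexHull_min hM (convex_halfSpace_le l.toLinearMap.isLinear M)
    -- The set on the right is convex: a combination with two positive weights reaches the maximum
    -- only if both of its points do.
    have key : convexHull ℝ s ⊆ {x | l x ≤ M ∧ (l x = M → x ∈ convexHull ℝ {x ∈ s | l x = M})} := by
      refine convexHull_min (fun x hx => ⟨hM x hx, fun h => subset_convexHull _ _ ⟨hx, h⟩⟩) ?_
      rintro x ⟨hx, hx'⟩ y ⟨hy, hy'⟩ a b ha hb hab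
      simp only [mem_ofPred_eq, map_add, map_smul, smul_eq_mul]
      have hMab : a * M + b * M = M := by rw [← add_mul, hab, one_mul]
      have hxa := mul_le_mul_of_nonneg_left hx ha
      have hyb := mul_le_mul_of_nonneg_left hy hb
      refine ⟨by linarith, fun h => ?_⟩
      rcases eq_or_lt_of_le ha with rfl | ha'
      · have : b = 1 := by linarith
        subst this
        simpa using hy' (by linarith)
      rcases eq_or_lt_of_le hb with rfl | hb''
      · have : a = 1 := by linarith
        subst this
        simpa using hx' (by linarith)
      have h1 : l x = M := mul_left_cancel₀ ha'.ne' (by linarith)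
      have h2 : l y = M := mul_left_cancel₀ hb''.ne' (by linarith)
      exact convex_convexHull ℝ _ (hx' h1) (hy' h2) ha hb hab
    rintro x ⟨hx, hx'⟩
    exact (key hx).2 hx'
  · intro x hx
    refine ⟨convexHull_mono (fun y hy => hy.1) hx, ?_⟩
    have : convexHull ℝ {x ∈ s | l x = M} ⊆ {x | l x = M} :=
      convexHull_min (fun y hy => hy.2) (convex_hyperplane l.toLinearMap.isLinear M)
    exact this hx

theorem vectorSpan_convexHull (s : Set E3) : vectorSpan ℝ (convexHull ℝ s) = vectorSpan ℝ s := by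
  rw [← direction_affineSpan, affineSpan_convexHull, direction_affineSpan]

section Labels

variable {n : ℕ}

/-- The convex hull of the points `v i` for `i ∈ I`. -/
def face (v : Fin n → E3) (I : Finset (Fin n)) : Set E3 := convexHull ℝ (v '' I)

/-- `I` is the (nonempty) set of labels of the points at which some linear functional is maximal. -/
def IsFaceLabel (v : Fin n → E3) (I : Finset (Fin n)) : Prop :=
  I.Nonempty ∧ ∃ (l : E3 →L[ℝ] ℝ) (M : ℝ), (∀ i, l (v i) ≤ M) ∧ ∀ i, i ∈ I ↔ l (v i) = M

/-- The label set records every generator on the supporting hyperplane, so it is determined by the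
face, and faces of the hull can be enumerated as subsets of `Fin n`. -/
theorem isFaceOfDim_iff (v : Fin n → E3) (d : ℕ) (F : Set E3) :
    IsFaceOfDim (convexHull ℝ (range v)) d F ↔
      ∃ I, IsFaceLabel v I ∧ F = face v I ∧ Module.finrank ℝ (vectorSpan ℝ (v '' I)) = d := by
  classical
  constructor
  · rintro ⟨hne, hexp, hd⟩
    obtain ⟨l, hl⟩ := hexp hne
    obtain ⟨x, hx⟩ := hne
    have hx' : x ∈ convexHull ℝ (range v) ∧ ∀ y ∈ convexHull ℝ (range v), l y ≤ l x := by
      rw [hl] at hx; exact hx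
    have hM : ∀ y ∈ range v, l y ≤ l x := fun y hy => hx'.2 y (subset_convexHull _ _ hy)
    have hF : F = {y ∈ convexHull ℝ (range v) | l y = l x} := by
      rw [hl]
      ext y
      refine ⟨fun h => ⟨h.1, le_antisymm (hx'.2 y h.1) (h.2 x hx'.1)⟩, fun h => ⟨h.1, fun z hz => ?_⟩⟩
      rw [h.2]; exact hx'.2 z hz
    have hI : v '' (Finset.univ.filter fun i => l (v i) = l x : Finset (Fin n)) =
        {y ∈ range v | l y = l x} := by
      ext y
      simp only [Finset.coe_filter, Finset.mem_univ, true_and, mem_image, mem_ofPred_eq, mem_range]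
      constructor
      · rintro ⟨i, hi, rfl⟩; exact ⟨⟨i, rfl⟩, hi⟩
      · rintro ⟨⟨i, rfl⟩, hi⟩; exact ⟨i, hi, rfl⟩
    have hF' : F = face v (Finset.univ.filter fun i => l (v i) = l x) := by
      rw [face, hI, hF, convexHull_inter_eq_max l hM]
    refine ⟨_, ⟨?_, l, l x, fun i => hM _ ⟨i, rfl⟩, by simp⟩, hF', ?_⟩
    · by_contra hemp
      rw [Finset.not_nonempty_iff_eq_empty] at hemp
      rw [hF', hemp] at hx
      simp [face] at hx
    · rw [← vectorSpan_convexHull]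
      rw [hF', face] at hd
      exact hd
  · rintro ⟨I, ⟨⟨i, hi⟩, l, M, hle, hI⟩, rfl, hd⟩
    have hM : ∀ y ∈ range v, l y ≤ M := by rintro _ ⟨i, rfl⟩; exact hle i
    have hIset : v '' I = {y ∈ range v | l y = M} := by
      ext y
      simp only [mem_image, mem_ofPred_eq, mem_range, Finset.mem_coe]
      constructor
      · rintro ⟨i, hi, rfl⟩; exact ⟨⟨i, rfl⟩, (hI i).1 hi⟩
      · rintro ⟨⟨i, rfl⟩, hi⟩; exact ⟨i, (hI i).2 hi, rfl⟩
    have hle' : ∀ y ∈ convexHull ℝ (range v), l y ≤ M :=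
      convexHull_min (t := {x | l x ≤ M}) hM (convex_halfSpace_le l.toLinearMap.isLinear M)
    refine ⟨⟨v i, subset_convexHull _ _ ⟨i, hi, rfl⟩⟩, fun _ => ⟨l, ?_⟩, ?_⟩
    · rw [face, hIset, ← convexHull_inter_eq_max l hM]
      ext y
      refine ⟨fun h => ⟨h.1, fun z hz => by rw [h.2]; exact hle' z hz⟩, fun h => ⟨h.1, ?_⟩⟩
      refine le_antisymm (hle' y h.1) ?_
      rw [← (hI i).1 hi]
      exact h.2 _ (subset_convexHull _ _ ⟨i, rfl⟩)
    · rw [face, vectorSpan_convexHull, hd]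

theorem IsFaceLabel.mem_face_iff {v : Fin n → E3} {I : Finset (Fin n)} (hI : IsFaceLabel v I)
    (i : Fin n) : v i ∈ face v I ↔ i ∈ I := by
  refine ⟨fun h => ?_, fun h => subset_convexHull _ _ ⟨i, h, rfl⟩⟩
  obtain ⟨-, l, M, -, hl⟩ := hI
  have : face v I ⊆ {x | l x = M} := by
    refine convexHull_min ?_ (convex_hyperplane l.toLinearMap.isLinear M)
    rintro _ ⟨j, hj, rfl⟩
    exact (hl j).1 hj
  exact (hl i).2 (this h)

theorem IsFaceLabel.face_subset_iff {v : Fin n → E3} {I J : Finset (Fin n)}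
    (hJ : IsFaceLabel v J) : face v I ⊆ face v J ↔ I ⊆ J := by
  refine ⟨fun h i hi => ?_, fun h => convexHull_mono (image_mono h)⟩
  exact (hJ.mem_face_iff i).1 (h (subset_convexHull _ _ ⟨i, hi, rfl⟩))

/-- `𝓔` and `𝓕` list the label sets of the edges and of the facets of the convex hull of `v`. -/
structure HasFaces (v : Fin n → E3) (𝓔 𝓕 : Finset (Finset (Fin n))) : Prop where
  edge : ∀ I, I ∈ 𝓔 ↔ IsFaceLabel v I ∧ Module.finrank ℝ (vectorSpan ℝ (v '' I)) = 1
  facet : ∀ I, I ∈ 𝓕 ↔ IsFaceLabel v I ∧ Module.finrank ℝ (vectorSpan ℝ (v '' I)) = 2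

variable {v : Fin n → E3} {𝓔 𝓕 : Finset (Finset (Fin n))}

theorem HasFaces.isFaceOfDim_one (hv : HasFaces v 𝓔 𝓕) (F : Set E3) :
    IsFaceOfDim (convexHull ℝ (range v)) 1 F ↔ ∃ I ∈ 𝓔, F = face v I := by
  rw [isFaceOfDim_iff]
  simp only [hv.edge]
  grind

theorem HasFaces.isFaceOfDim_two (hv : HasFaces v 𝓔 𝓕) (F : Set E3) :
    IsFaceOfDim (convexHull ℝ (range v)) 2 F ↔ ∃ I ∈ 𝓕, F = face v I := by
  rw [isFaceOfDim_iff]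
  simp only [hv.facet]
  grind

/-- A face determines its label set, so reindexing the finsum by labels counts each edge once. -/
theorem HasFaces.dehn_eq_sum (hv : HasFaces v 𝓔 𝓕) :
    dehn (convexHull ℝ (range v)) = ∑ I ∈ 𝓔, Metric.diam (face v I) ⊗ₜ[ℤ]
      ((dihedralAngle (convexHull ℝ (range v)) (face v I) : ℝ) : AddCircle Real.pi) := by
  have h : edges (convexHull ℝ (range v)) = face v '' 𝓔 := by
    ext F
    rw [edges, mem_ofPred_eq, hv.isFaceOfDim_one]
    simp only [mem_image, Finset.mem_coe, eq_comm]
  rw [dehn, h, finsum_mem_image, finsum_mem_coe_finset]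
  intro I hI J hJ hIJ
  apply subset_antisymm
  · exact ((hv.edge J).1 hJ).1.face_subset_iff.1 hIJ.subset
  · exact ((hv.edge I).1 hI).1.face_subset_iff.1 hIJ.superset

end Labels

/-! ### Dihedral angles as angles between half-planes -/

/-- The component of `r - p` perpendicular to the line `p q`. -/
def perpPart (p q r : E3) : E3 :=
  (r - p) - (inner ℝ (q - p) (r - p) / inner ℝ (q - p) (q - p)) • (q - p)

/-- The angle at the line `p q` between the half-planes through `r` and through `s`. -/
def hingeAngle (p q r s : E3) : ℝ :=
  InnerProductGeometry.angle (perpPart p q r) (perpPart p q s)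

theorem inner_perpPart (p q r : E3) : inner ℝ (q - p) (perpPart p q r) = 0 := by
  rw [perpPart, inner_sub_right, inner_smul_right]
  by_cases h : q - p = 0
  · simp [h]
  · rw [div_mul_cancel₀ _ (by simpa using h), sub_self]

/-- A point of the closed half-plane bounded by the line `p q` through `r` differs from a foot point
on that line by a nonnegative multiple of `perpPart p q r`. -/
theorem sub_eq_smul_perpPart {p q r x y : E3} {F : Set E3}
    (hF : F ⊆ {x | ∃ a b : ℝ, 0 ≤ b ∧ x = p + a • (q - p) + b • (r - p)})
    (hx : x ∈ F) (hy : y ∈ affineSpan ℝ (segment ℝ p q)) (hxy : x ≠ y)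
    (hperp : x - y ∈ (vectorSpan ℝ (segment ℝ p q))ᗮ) :
    ∃ b : ℝ, 0 < b ∧ x - y = b • perpPart p q r := by
  obtain ⟨a, b, hb, rfl⟩ := hF hx
  rw [← convexHull_pair, affineSpan_convexHull] at hy
  rw [← convexHull_pair, vectorSpan_convexHull, Submodule.mem_orthogonal] at hperp
  obtain ⟨c, rfl⟩ := mem_affineSpan_pair_iff_exists_lineMap_eq.1 hy
  have h1 := hperp (q - p) (mem_vectorSpan_pair_rev.2 ⟨1, by simp⟩)
  simp only [AffineMap.lineMap_apply, vsub_eq_sub, vadd_eq_add] at h1 hxy ⊢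
  have h2 : p + a • (q - p) + b • (r - p) - (c • (q - p) + p) =
      b • perpPart p q r +
        (a - c + b * (inner ℝ (q - p) (r - p) / inner ℝ (q - p) (q - p))) • (q - p) := by
    rw [perpPart]; module
  rw [h2, inner_add_right, inner_smul_right, inner_perpPart, mul_zero, zero_add, inner_smul_right,
    mul_eq_zero, inner_self_eq_zero] at h1
  have h3 : (a - c + b * (inner ℝ (q - p) (r - p) / inner ℝ (q - p) (q - p))) • (q - p) = 0 := by
    rcases h1 with h1 | h1 <;> rw [h1] <;> simp
  rw [h3, add_zero] at h2
  refine ⟨b, lt_of_le_of_ne hb ?_, h2⟩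
  intro hb0
  rw [← hb0, zero_smul ℝ (perpPart p q r), sub_eq_zero] at h2
  exact hxy (by rw [← hb0]; exact h2)

/-- Each of the two facets lies in a closed half-plane bounded by the edge, so every admissible
perpendicular vector is a positive multiple of a fixed one. The set of angles is therefore a
singleton and the supremum in `dihedralAngle` is harmless. -/
theorem dihedralAngle_eq {P F G : Set E3} {p q r s : E3}
    (hF : IsFaceOfDim P 2 F) (hG : IsFaceOfDim P 2 G) (hFG : F ≠ G)
    (hpF : segment ℝ p q ⊆ F) (hpG : segment ℝ p q ⊆ G)
    (honly : ∀ H, IsFaceOfDim P 2 H → segment ℝ p q ⊆ H → H = F ∨ H = G)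
    (hr : r ∈ F) (hs : s ∈ G) (hr0 : perpPart p q r ≠ 0) (hs0 : perpPart p q s ≠ 0)
    (hFr : F ⊆ {x | ∃ a b : ℝ, 0 ≤ b ∧ x = p + a • (q - p) + b • (r - p)})
    (hGs : G ⊆ {x | ∃ a b : ℝ, 0 ≤ b ∧ x = p + a • (q - p) + b • (s - p)}) :
    dihedralAngle P (segment ℝ p q) = hingeAngle p q r s := by
  have foot : ∀ r : E3, perpPart p q r ≠ 0 → ∃ y ∈ affineSpan ℝ (segment ℝ p q), r ≠ y ∧
      r - y ∈ (vectorSpan ℝ (segment ℝ p q))ᗮ ∧ r - y = perpPart p q r := by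
    intro r hr0
    have h2 : r - (p + (inner ℝ (q - p) (r - p) / inner ℝ (q - p) (q - p)) • (q - p)) =
        perpPart p q r := by rw [perpPart]; module
    refine ⟨p + (inner ℝ (q - p) (r - p) / inner ℝ (q - p) (q - p)) • (q - p), ?_, ?_, ?_, h2⟩
    · rw [← convexHull_pair, affineSpan_convexHull, mem_affineSpan_pair_iff_exists_lineMap_eq]
      exact ⟨_, by rw [AffineMap.lineMap_apply, vsub_eq_sub, vadd_eq_add, add_comm]⟩
    · rw [← sub_ne_zero, h2]; exact hr0
    · rw [h2, ← convexHull_pair, vectorSpan_convexHull, vectorSpan_pair_rev, vsub_eq_sub,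
        Submodule.mem_orthogonal_singleton_iff_inner_right]
      exact inner_perpPart p q r
  have hset : {θ | IsDihedralAngle P (segment ℝ p q) θ} = {hingeAngle p q r s} := by
    ext θ
    simp only [mem_ofPred_eq, mem_singleton_iff]
    constructor
    · rintro ⟨F', G', hF', hG', hne, heF, heG, x, hx, y, hy, x₀, hx₀, y₀, hy₀, hxx, hyy, hxp, hyp,
        rfl⟩
      rcases honly F' hF' heF with rfl | rfl <;> rcases honly G' hG' heG with rfl | rfl
      · exact absurd rfl hne
      · obtain ⟨b, hb, h1⟩ := sub_eq_smul_perpPart hFr hx hx₀ hxx hxp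
        obtain ⟨c, hc, h2⟩ := sub_eq_smul_perpPart hGs hy hy₀ hyy hyp
        rw [h1, h2, InnerProductGeometry.angle_smul_left_of_pos _ _ hb,
          InnerProductGeometry.angle_smul_right_of_pos _ _ hc, hingeAngle]
      · obtain ⟨b, hb, h1⟩ := sub_eq_smul_perpPart hGs hx hx₀ hxx hxp
        obtain ⟨c, hc, h2⟩ := sub_eq_smul_perpPart hFr hy hy₀ hyy hyp
        rw [h1, h2, InnerProductGeometry.angle_smul_left_of_pos _ _ hb,
          InnerProductGeometry.angle_smul_right_of_pos _ _ hc, hingeAngle,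
          InnerProductGeometry.angle_comm]
      · exact absurd rfl hne
    · rintro rfl
      obtain ⟨x₀, h1, h2, h3, h4⟩ := foot r hr0
      obtain ⟨y₀, k1, k2, k3, k4⟩ := foot s hs0
      exact ⟨F, G, hF, hG, hFG, hpF, hpG, r, hr, s, hs, x₀, h1, y₀, k1, h2, k2, h3, k3,
        by rw [h4, k4, hingeAngle]⟩
  rw [dihedralAngle, hset, csSup_singleton]

section Labels

variable {n : ℕ} {v : Fin n → E3} {𝓔 𝓕 : Finset (Finset (Fin n))}

theorem face_pair (v : Fin n → E3) (i j : Fin n) : face v {i, j} = segment ℝ (v i) (v j) := by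
  rw [face, Finset.coe_pair, image_pair, convexHull_pair]

/-- The functional exposing the edge is constant on its line, so a third generator on that line
would also carry a label of the edge. -/
theorem HasFaces.perpPart_ne_zero (hv : HasFaces v 𝓔 𝓕) {i j r : Fin n} (hij : {i, j} ∈ 𝓔)
    (hri : r ≠ i) (hrj : r ≠ j) : perpPart (v i) (v j) (v r) ≠ 0 := by
  intro h
  obtain ⟨⟨-, l, M, -, hl⟩, -⟩ := (hv.edge _).1 hij
  rw [perpPart, sub_eq_zero] at h
  have hi := (hl i).1 (by simp)
  have hj := (hl j).1 (by simp)
  have h' := congrArg l h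
  simp only [map_sub, map_smul, hi, hj, sub_self, smul_zero, sub_eq_zero] at h'
  simpa [hri, hrj] using (hl r).2 h'

theorem HasFaces.dihedralAngle_eq (hv : HasFaces v 𝓔 𝓕) {i j r s : Fin n} {J K : Finset (Fin n)}
    (hij : {i, j} ∈ 𝓔) (hJK : 𝓕.filter ({i, j} ⊆ ·) = {J, K}) (hne : J ≠ K)
    (hr : r ∈ J) (hs : s ∈ K) (hri : r ≠ i) (hrj : r ≠ j) (hsi : s ≠ i) (hsj : s ≠ j)
    (hJ : ∀ k ∈ J, ∃ a b : ℝ, 0 ≤ b ∧ v k = v i + a • (v j - v i) + b • (v r - v i))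
    (hK : ∀ k ∈ K, ∃ a b : ℝ, 0 ≤ b ∧ v k = v i + a • (v j - v i) + b • (v s - v i)) :
    dihedralAngle (convexHull ℝ (range v)) (face v {i, j}) =
      hingeAngle (v i) (v j) (v r) (v s) := by
  have hmem : ∀ H, (H ∈ 𝓕 ∧ {i, j} ⊆ H) ↔ (H = J ∨ H = K) := by
    intro H
    have := congrArg (H ∈ ·) hJK
    simpa using this
  obtain ⟨hJF, hJ'⟩ := (hmem J).2 (Or.inl rfl)
  obtain ⟨hKF, hK'⟩ := (hmem K).2 (Or.inr rfl)
  have lJ := ((hv.facet J).1 hJF).1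
  have lK := ((hv.facet K).1 hKF).1
  have conv : ∀ r, Convex ℝ {x | ∃ a b : ℝ, 0 ≤ b ∧ x = v i + a • (v j - v i) + b • (r - v i)} := by
    rintro r _ ⟨a, b, hb, rfl⟩ _ ⟨a', b', hb', rfl⟩ s t hs ht hst
    refine ⟨s * a + t * a', s * b + t * b', by positivity, ?_⟩
    obtain rfl : t = 1 - s := by linarith
    module
  rw [face_pair]
  refine _root_.dihedralAngle_eq (F := face v J) (G := face v K) ?_ ?_ ?_ ?_ ?_ ?_
    ((lJ.mem_face_iff r).2 hr) ((lK.mem_face_iff s).2 hs)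
    (hv.perpPart_ne_zero hij hri hrj) (hv.perpPart_ne_zero hij hsi hsj)
    (convexHull_min ?_ (conv _)) (convexHull_min ?_ (conv _))
  · exact (hv.isFaceOfDim_two _).2 ⟨J, hJF, rfl⟩
  · exact (hv.isFaceOfDim_two _).2 ⟨K, hKF, rfl⟩
  · intro h
    exact hne (subset_antisymm (lK.face_subset_iff.1 h.subset) (lJ.face_subset_iff.1 h.superset))
  · rw [← face_pair]; exact lJ.face_subset_iff.2 hJ'
  · rw [← face_pair]; exact lK.face_subset_iff.2 hK'
  · intro H hH hsub
    obtain ⟨I, hI, rfl⟩ := (hv.isFaceOfDim_two _).1 hH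
    rw [← face_pair, ((hv.facet I).1 hI).1.face_subset_iff] at hsub
    rcases (hmem I).1 ⟨hI, hsub⟩ with rfl | rfl <;> simp
  · rintro _ ⟨k, hk, rfl⟩; exact hJ k hk
  · rintro _ ⟨k, hk, rfl⟩; exact hK k hk

theorem diam_face_pair (v : Fin n → E3) (i j : Fin n) :
    Metric.diam (face v {i, j}) = dist (v i) (v j) := by
  rw [face, convexHull_diam, Finset.coe_pair, image_pair, Metric.diam_pair]

end Labels

end

/-! ### Faces and Dehn invariant of a tetrahedron -/

noncomputable section

open Set

theorem affineIndependent_fin_four_iff {p : Fin 4 → E3} :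
    AffineIndependent ℝ p ↔ ∀ a b c d : ℝ, a + b + c + d = 0 →
      a • p 0 + b • p 1 + c • p 2 + d • p 3 = 0 → a = 0 ∧ b = 0 ∧ c = 0 ∧ d = 0 := by
  rw [affineIndependent_iff_of_fintype]
  constructor
  · intro h a b c d h1 h2
    have := h ![a, b, c, d] (by simpa [Fin.sum_univ_four] using h1) (by
      rw [Finset.weightedVSub_eq_linear_combination]
      · simpa [Fin.sum_univ_four] using h2
      · simpa [Fin.sum_univ_four] using h1)
    exact ⟨this 0, this 1, this 2, this 3⟩
  · intro h w h1 h2 i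
    rw [Finset.weightedVSub_eq_linear_combination (hw := h1)] at h2
    rw [Fin.sum_univ_four] at h1 h2
    obtain ⟨h0, h1, h2, h3⟩ := h _ _ _ _ h1 h2
    fin_cases i <;> assumption

/-- Combine the barycentric coordinate functions with weights `f i`; the constant c absorbs the
difference between an affine function and its linear part. -/
theorem AffineIndependent.exists_clm_eq_add_const {v : Fin 4 → E3} (hv : AffineIndependent ℝ v)
    (f : Fin 4 → ℝ) : ∃ (l : E3 →L[ℝ] ℝ) (c : ℝ), ∀ i, l (v i) = f i + c := by
  let b : AffineBasis (Fin 4) ℝ E3 :=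
    ⟨v, hv, hv.affineSpan_eq_top_iff_card_eq_finrank_add_one.2 (by simp)⟩
  have hb : ∀ i j, b.coord i (v j) = if i = j then 1 else 0 := fun i j => b.coord_apply i j
  refine ⟨LinearMap.toContinuousLinearMap (∑ i, f i • (b.coord i).linear),
    -∑ i, f i * b.coord i 0, fun j => ?_⟩
  have h : ∀ i, (b.coord i).linear (v j) = (if i = j then 1 else 0) - b.coord i 0 := by
    intro i
    rw [← hb i j, ← vsub_eq_sub, ← AffineMap.linearMap_vsub, vsub_eq_sub, sub_zero]
  simp only [LinearMap.coe_toContinuousLinearMap', LinearMap.coe_sum, Finset.sum_apply,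
    LinearMap.smul_apply, smul_eq_mul, h, mul_sub, Finset.sum_sub_distrib]
  simp [sub_eq_add_neg]

theorem AffineIndependent.finrank_vectorSpan_image_add_one {n : ℕ} {v : Fin n → E3}
    (hv : AffineIndependent ℝ v) {I : Finset (Fin n)} (hI : I.Nonempty) :
    Module.finrank ℝ (vectorSpan ℝ (v '' I)) + 1 = I.card := by
  classical
  have h := Finset.card_pos.2 hI
  have := hv.finrank_vectorSpan_image_finset (s := I) (n := I.card - 1) (by omega)
  rw [Finset.coe_image] at this
  omega

/-- A functional can take the value 1 on any chosen vertices and 0 on the rest, up to a constant, so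
every nonempty label set is a face; affine independence turns its dimension into its cardinality
minus one. -/
theorem AffineIndependent.hasFaces_tetrahedron {v : Fin 4 → E3} (hv : AffineIndependent ℝ v) :
    HasFaces v (Finset.univ.powersetCard 2) (Finset.univ.powersetCard 3) := by
  have key : ∀ (I : Finset (Fin 4)) (d : ℕ), 0 < d → (I ∈ Finset.univ.powersetCard (d + 1) ↔
      IsFaceLabel v I ∧ Module.finrank ℝ (vectorSpan ℝ (v '' I)) = d) := by
    intro I d hd
    rw [Finset.mem_powersetCard_univ]
    constructor
    · intro h
      have hne : I.Nonempty := by rw [← Finset.card_pos]; omega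
      obtain ⟨l, c, hl⟩ := hv.exists_clm_eq_add_const (fun i => if i ∈ I then 1 else 0)
      refine ⟨⟨hne, l, 1 + c, fun i => ?_, fun i => ?_⟩, ?_⟩
      · rw [hl]; split_ifs <;> linarith
      · rw [hl]; split_ifs with h <;> simp [h]
      · have := hv.finrank_vectorSpan_image_add_one hne; omega
    · rintro ⟨⟨hne, -⟩, h⟩
      have := hv.finrank_vectorSpan_image_add_one hne
      omega
  exact ⟨fun I => key I 1 one_pos, fun I => key I 2 two_pos⟩

theorem triangle_subset_halfPlane {n : ℕ} (v : Fin n → E3) (i j r : Fin n) :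
    ∀ k ∈ ({i, j, r} : Finset (Fin n)),
      ∃ a b : ℝ, 0 ≤ b ∧ v k = v i + a • (v j - v i) + b • (v r - v i) := by
  intro k hk
  simp only [Finset.mem_insert, Finset.mem_singleton] at hk
  rcases hk with rfl | rfl | rfl
  · exact ⟨0, 0, le_rfl, by simp⟩
  · exact ⟨1, 0, le_rfl, by simp⟩
  · exact ⟨0, 1, zero_le_one, by simp⟩

/-- The Dehn invariant of a tetrahedron. -/
theorem dehn_tetrahedron {v : Fin 4 → E3} (hv : AffineIndependent ℝ v) :
    dehn (convexHull ℝ (range v)) =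
      dist (v 0) (v 1) ⊗ₜ[ℤ] (hingeAngle (v 0) (v 1) (v 2) (v 3) : AddCircle Real.pi) +
      dist (v 0) (v 2) ⊗ₜ[ℤ] (hingeAngle (v 0) (v 2) (v 1) (v 3) : AddCircle Real.pi) +
      dist (v 0) (v 3) ⊗ₜ[ℤ] (hingeAngle (v 0) (v 3) (v 1) (v 2) : AddCircle Real.pi) +
      dist (v 1) (v 2) ⊗ₜ[ℤ] (hingeAngle (v 1) (v 2) (v 0) (v 3) : AddCircle Real.pi) +
      dist (v 1) (v 3) ⊗ₜ[ℤ] (hingeAngle (v 1) (v 3) (v 0) (v 2) : AddCircle Real.pi) +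
      dist (v 2) (v 3) ⊗ₜ[ℤ] (hingeAngle (v 2) (v 3) (v 0) (v 1) : AddCircle Real.pi) := by
  have hf := hv.hasFaces_tetrahedron
  have hc : ∀ i j r s : Fin 4, [i, j, r, s].Nodup →
      {i, j} ∈ (Finset.univ : Finset (Fin 4)).powersetCard 2 ∧
      ((Finset.univ : Finset (Fin 4)).powersetCard 3).filter ({i, j} ⊆ ·) = {{i, j, r}, {i, j, s}} ∧
      ({i, j, r} : Finset (Fin 4)) ≠ {i, j, s} := by decide
  have h : ∀ i j r s : Fin 4, [i, j, r, s].Nodup →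
      dihedralAngle (convexHull ℝ (range v)) (face v {i, j}) =
        hingeAngle (v i) (v j) (v r) (v s) := by
    intro i j r s hn
    have hn' := hn
    simp only [List.nodup_cons, List.mem_cons, List.not_mem_nil, or_false, not_or] at hn
    refine hf.dihedralAngle_eq (J := {i, j, r}) (K := {i, j, s}) ?_ ?_ ?_ (by simp) (by simp)
      (by tauto) (by tauto) (by tauto) (by tauto) (triangle_subset_halfPlane v i j r)
      (triangle_subset_halfPlane v i j s)
    · exact (hc i j r s hn').1
    · exact (hc i j r s hn').2.1
    · exact (hc i j r s hn').2.2
  rw [hf.dehn_eq_sum, show (Finset.univ.powersetCard 2 : Finset (Finset (Fin 4))) =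
    {{0, 1}, {0, 2}, {0, 3}, {1, 2}, {1, 3}, {2, 3}} by decide]
  rw [Finset.sum_insert (by decide), Finset.sum_insert (by decide), Finset.sum_insert (by decide),
    Finset.sum_insert (by decide), Finset.sum_insert (by decide), Finset.sum_singleton]
  simp only [diam_face_pair]
  rw [h 0 1 2 3 (by decide), h 0 2 1 3 (by decide), h 0 3 1 2 (by decide), h 1 2 0 3 (by decide),
    h 1 3 0 2 (by decide), h 2 3 0 1 (by decide)]
  abel


/-! ### Faces and Dehn invariant of a pyramid over a parallelogram -/

/-- Label sets of the edges of a pyramid with base `0, 1, 2, 3` and apex `4`. -/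
def pyramidEdges : Finset (Finset (Fin 5)) :=
  {{0, 1}, {1, 2}, {2, 3}, {3, 0}, {0, 4}, {1, 4}, {2, 4}, {3, 4}}

/-- Label sets of the facets of a pyramid with base `0, 1, 2, 3` and apex `4`. -/
def pyramidFacets : Finset (Finset (Fin 5)) :=
  {{0, 1, 4}, {1, 2, 4}, {2, 3, 4}, {3, 0, 4}, {0, 1, 2, 3}}

section Pyramid

variable {v : Fin 5 → E3}

/-- The parallelogram relation is the only affine dependence among the five points and involves all
four base points, so dropping any one of these leaves an independent family. -/
theorem affineIndependent_pyramid_succAbove (hpar : v 0 + v 2 = v 1 + v 3)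
    (hv : AffineIndependent ℝ ![v 0, v 1, v 3, v 4]) (j : Fin 5) (hj : j ≠ 4) :
    AffineIndependent ℝ (v ∘ j.succAbove) := by
  rw [affineIndependent_fin_four_iff] at hv ⊢
  have h2 : v 2 = v 1 + v 3 - v 0 := by rw [← hpar]; abel
  intro a b c d h0 h1
  simp only [Function.comp_apply] at h1
  fin_cases j
  · have h1' : a • v 1 + b • v 2 + c • v 3 + d • v 4 = 0 := h1
    rw [h2] at h1'
    obtain ⟨k1, k2, k3, k4⟩ := hv (-b) (a + b) (c + b) d (by linarith) (by
      rw [← h1']; simp only [Matrix.cons_val]; module)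
    refine ⟨?_, ?_, ?_, ?_⟩ <;> linarith
  · have h1' : a • v 0 + b • v 2 + c • v 3 + d • v 4 = 0 := h1
    rw [h2] at h1'
    obtain ⟨k1, k2, k3, k4⟩ := hv (a - b) b (c + b) d (by linarith) (by
      rw [← h1']; simp only [Matrix.cons_val]; module)
    refine ⟨?_, ?_, ?_, ?_⟩ <;> linarith
  · exact hv a b c d h0 h1
  · have h1' : a • v 0 + b • v 1 + c • v 2 + d • v 4 = 0 := h1
    rw [h2] at h1'
    obtain ⟨k1, k2, k3, k4⟩ := hv (a - c) (b + c) c d (by linarith) (by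
      rw [← h1']; simp only [Matrix.cons_val]; module)
    refine ⟨?_, ?_, ?_, ?_⟩ <;> linarith
  · exact absurd rfl hj

theorem finrank_vectorSpan_pyramid_add_one (hpar : v 0 + v 2 = v 1 + v 3)
    (hv : AffineIndependent ℝ ![v 0, v 1, v 3, v 4]) {I : Finset (Fin 5)} (hI : I.Nonempty)
    {j : Fin 5} (hj : j ≠ 4) (hjI : j ∉ I) :
    Module.finrank ℝ (vectorSpan ℝ (v '' I)) + 1 = I.card := by
  have hmap : I = (Finset.univ.filter fun i : Fin 4 => j.succAbove i ∈ I).map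
      j.succAboveEmb := by
    revert I j; decide
  have hne : (Finset.univ.filter fun i : Fin 4 => j.succAbove i ∈ I).Nonempty := by
    rw [hmap, Finset.map_nonempty] at hI; exact hI
  have := (affineIndependent_pyramid_succAbove hpar hv j hj).finrank_vectorSpan_image_add_one hne
  rw [image_comp] at this
  conv_lhs => rw [hmap]
  conv_rhs => rw [hmap]
  rw [Finset.coe_map, Finset.card_map]
  exact this

theorem finrank_vectorSpan_pyramid_base (hpar : v 0 + v 2 = v 1 + v 3)
    (hv : AffineIndependent ℝ ![v 0, v 1, v 3, v 4]) :
    Module.finrank ℝ (vectorSpan ℝ (v '' ({0, 1, 2, 3} : Finset (Fin 5)))) = 2 := by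
  have h2 : v 2 = v 1 + v 3 - v 0 := by rw [← hpar]; abel
  have h := finrank_vectorSpan_pyramid_add_one hpar hv (I := {0, 1, 3}) (by simp) (j := 2)
    (by decide) (by decide)
  rw [show ({0, 1, 3} : Finset (Fin 5)).card = 3 by decide] at h
  have heq : affineSpan ℝ (v '' ({0, 1, 2, 3} : Finset (Fin 5))) =
      affineSpan ℝ (v '' ({0, 1, 3} : Finset (Fin 5))) := by
    apply le_antisymm
    · rw [affineSpan_le]
      have hm : ∀ i ∈ ({0, 1, 3} : Finset (Fin 5)),
          v i ∈ affineSpan ℝ (v '' ({0, 1, 3} : Finset (Fin 5))) :=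
        fun i hi => subset_affineSpan ℝ _ ⟨i, hi, rfl⟩
      rintro _ ⟨k, hk, rfl⟩
      rw [Finset.mem_coe] at hk
      by_cases hk2 : k = 2
      · subst hk2
        rw [h2]
        have := AffineSubspace.smul_vsub_vadd_mem _ 1 (hm 1 (by decide)) (hm 0 (by decide))
          (hm 3 (by decide))
        rw [one_smul, vsub_eq_sub, vadd_eq_add] at this
        rw [SetLike.mem_coe]
        convert this using 1
        abel
      · exact hm k (by revert k; decide)
    · exact affineSpan_mono ℝ (image_mono (Finset.coe_subset.2 (by decide)))
  rw [← direction_affineSpan, heq, direction_affineSpan]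
  omega

theorem finrank_vectorSpan_pyramid_univ (hv : AffineIndependent ℝ ![v 0, v 1, v 3, v 4]) :
    3 ≤ Module.finrank ℝ (vectorSpan ℝ (v '' (Finset.univ : Finset (Fin 5)))) := by
  have h := hv.finrank_vectorSpan (n := 3) (by simp)
  refine h.symm.le.trans (Submodule.finrank_mono (vectorSpan_mono ℝ ?_))
  rintro _ ⟨k, rfl⟩
  fin_cases k <;> simp

/-- Values at `0, 1, 3, 4` can be prescribed freely and the parallelogram relation fixes the value
at `2`; the condition on `f` is this compatibility. -/
theorem isFaceLabel_pyramid (hpar : v 0 + v 2 = v 1 + v 3)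
    (hv : AffineIndependent ℝ ![v 0, v 1, v 3, v 4]) (f : Fin 5 → ℤ) (hf : ∀ i, f i ≤ 0)
    (hf2 : f 0 + f 2 = f 1 + f 3) (hf0 : ∃ i, f i = 0) :
    IsFaceLabel v (Finset.univ.filter fun i => f i = 0) := by
  obtain ⟨l, c, hl⟩ := hv.exists_clm_eq_add_const ![(f 0 : ℝ), f 1, f 3, f 4]
  have h0 : l (v 0) = f 0 + c := hl 0
  have h1 : l (v 1) = f 1 + c := hl 1
  have h3 : l (v 3) = f 3 + c := hl 2
  have h4 : l (v 4) = f 4 + c := hl 3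
  have h2 : l (v 2) = f 2 + c := by
    have e1 := congrArg l hpar
    have e2 : (f 0 + f 2 : ℝ) = f 1 + f 3 := by exact_mod_cast hf2
    rw [map_add, map_add] at e1
    linarith
  have h : ∀ i, l (v i) = f i + c := by
    intro i; fin_cases i <;> assumption
  refine ⟨?_, l, c, fun i => ?_, fun i => ?_⟩
  · obtain ⟨i, hi⟩ := hf0
    exact ⟨i, by simp [hi]⟩
  · have : (f i : ℝ) ≤ 0 := by exact_mod_cast hf i
    rw [h]; linarith
  · rw [h]; simp

/-- The two diagonals share their midpoint, so a functional is maximal at both ends of one exactly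
when it is at both ends of the other. This excludes all label sets that are not faces. -/
theorem IsFaceLabel.diagonal_iff (hpar : v 0 + v 2 = v 1 + v 3) {I : Finset (Fin 5)}
    (hI : IsFaceLabel v I) : (0 ∈ I ∧ 2 ∈ I) ↔ (1 ∈ I ∧ 3 ∈ I) := by
  obtain ⟨-, l, M, hle, hl⟩ := hI
  have e1 := congrArg l hpar
  rw [map_add, map_add] at e1
  have := hle 0
  have := hle 1
  have := hle 2
  have := hle 3
  simp only [hl]
  constructor <;> rintro ⟨h, h'⟩ <;> constructor <;> linarith

theorem hasFaces_pyramid (hpar : v 0 + v 2 = v 1 + v 3)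
    (hv : AffineIndependent ℝ ![v 0, v 1, v 3, v 4]) :
    HasFaces v pyramidEdges pyramidFacets := by
  have label : ∀ I ∈ pyramidEdges ∪ pyramidFacets, IsFaceLabel v I := by
    have hl := isFaceLabel_pyramid hpar hv
    -- The vectors list the values, on the five vertices, of a supporting functional for each edge
    -- and facet, normalised to have maximum 0.
    have key : ∀ I ∈ pyramidEdges ∪ pyramidFacets,
        ∃ f ∈ ({![0, 0, -1, -1, -1], ![-1, 0, 0, -1, -1], ![-1, -1, 0, 0, -1], ![0, -1, -1, 0, -1],
          ![0, -1, -2, -1, 0], ![-1, 0, -1, -2, 0], ![-2, -1, 0, -1, 0], ![-1, -2, -1, 0, 0],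
          ![0, 0, -1, -1, 0], ![-1, 0, 0, -1, 0], ![-1, -1, 0, 0, 0], ![0, -1, -1, 0, 0],
          ![0, 0, 0, 0, -1]} : Finset (Fin 5 → ℤ)),
          (∀ i, f i ≤ 0) ∧ f 0 + f 2 = f 1 + f 3 ∧ (∃ i, f i = 0) ∧
            I = Finset.univ.filter fun i => f i = 0 := by decide
    intro I hI
    obtain ⟨f, -, h1, h2, h3, rfl⟩ := key I hI
    exact hl f h1 h2 h3
  -- Apart from the whole set and the base, a label set satisfying the diagonal condition omits a
  -- base vertex, so its dimension is again read from its cardinality.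
  have classify : ∀ I : Finset (Fin 5), I.Nonempty → ((0 ∈ I ∧ 2 ∈ I) ↔ (1 ∈ I ∧ 3 ∈ I)) →
      I = Finset.univ ∨ I = {0, 1, 2, 3} ∨ ((∃ j : Fin 5, j ≠ 4 ∧ j ∉ I) ∧
        (I.card = 2 → I ∈ pyramidEdges) ∧ (I.card = 3 → I ∈ pyramidFacets)) := by decide
  have hbase := finrank_vectorSpan_pyramid_base hpar hv
  have huniv := finrank_vectorSpan_pyramid_univ hv
  refine ⟨fun I => ⟨fun hI => ?_, ?_⟩, fun I => ⟨fun hI => ?_, ?_⟩⟩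
  · have lI := label I (Finset.mem_union_left _ hI)
    have hcard : ∀ I ∈ pyramidEdges, I.card = 2 ∧ ∃ j : Fin 5, j ≠ 4 ∧ j ∉ I := by decide
    obtain ⟨hc, j, hj, hjI⟩ := hcard I hI
    have := finrank_vectorSpan_pyramid_add_one hpar hv lI.1 hj hjI
    exact ⟨lI, by omega⟩
  · rintro ⟨lI, hd⟩
    rcases classify I lI.1 (lI.diagonal_iff hpar) with rfl | rfl | ⟨⟨j, hj, hjI⟩, h2, -⟩
    · omega
    · omega
    · have := finrank_vectorSpan_pyramid_add_one hpar hv lI.1 hj hjI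
      exact h2 (by omega)
  · have lI := label I (Finset.mem_union_right _ hI)
    have hcard : ∀ I ∈ pyramidFacets,
        I = {0, 1, 2, 3} ∨ (I.card = 3 ∧ ∃ j : Fin 5, j ≠ 4 ∧ j ∉ I) := by decide
    rcases hcard I hI with rfl | ⟨hc, j, hj, hjI⟩
    · exact ⟨lI, hbase⟩
    · have := finrank_vectorSpan_pyramid_add_one hpar hv lI.1 hj hjI
      exact ⟨lI, by omega⟩
  · rintro ⟨lI, hd⟩
    rcases classify I lI.1 (lI.diagonal_iff hpar) with rfl | rfl | ⟨⟨j, hj, hjI⟩, -, h2⟩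
    · omega
    · decide
    · have := finrank_vectorSpan_pyramid_add_one hpar hv lI.1 hj hjI
      exact h2 (by omega)

/-- The Dehn invariant of a pyramid over a parallelogram. -/
theorem dehn_pyramid (hpar : v 0 + v 2 = v 1 + v 3)
    (hv : AffineIndependent ℝ ![v 0, v 1, v 3, v 4]) :
    dehn (convexHull ℝ (range v)) =
      dist (v 0) (v 1) ⊗ₜ[ℤ] (hingeAngle (v 0) (v 1) (v 3) (v 4) : AddCircle Real.pi) +
      dist (v 1) (v 2) ⊗ₜ[ℤ] (hingeAngle (v 1) (v 2) (v 0) (v 4) : AddCircle Real.pi) +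
      dist (v 2) (v 3) ⊗ₜ[ℤ] (hingeAngle (v 2) (v 3) (v 1) (v 4) : AddCircle Real.pi) +
      dist (v 3) (v 0) ⊗ₜ[ℤ] (hingeAngle (v 3) (v 0) (v 2) (v 4) : AddCircle Real.pi) +
      dist (v 0) (v 4) ⊗ₜ[ℤ] (hingeAngle (v 0) (v 4) (v 1) (v 3) : AddCircle Real.pi) +
      dist (v 1) (v 4) ⊗ₜ[ℤ] (hingeAngle (v 1) (v 4) (v 0) (v 2) : AddCircle Real.pi) +
      dist (v 2) (v 4) ⊗ₜ[ℤ] (hingeAngle (v 2) (v 4) (v 1) (v 3) : AddCircle Real.pi) +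
      dist (v 3) (v 4) ⊗ₜ[ℤ] (hingeAngle (v 3) (v 4) (v 2) (v 0) : AddCircle Real.pi) := by
  have hf := hasFaces_pyramid hpar hv
  have h2 : v 2 = v 1 + v 3 - v 0 := by rw [← hpar]; abel
  -- Here `t` is the base vertex opposite `i`; it lies in the half-plane through `r` because it is
  -- `v j + (v r - v i)`.
  have base : ∀ i j r t : Fin 5, {i, j, r, t} = ({0, 1, 2, 3} : Finset (Fin 5)) →
      v t = v j + v r - v i →
      {i, j} ∈ pyramidEdges → pyramidFacets.filter ({i, j} ⊆ ·) = {{0, 1, 2, 3}, {i, j, 4}} →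
      r ≠ i → r ≠ j → i ≠ 4 → j ≠ 4 →
      dihedralAngle (convexHull ℝ (range v)) (face v {i, j}) =
        hingeAngle (v i) (v j) (v r) (v 4) := by
    intro i j r t hset ht hij hfac hri hrj hi4 hj4
    rw [← hset] at hfac
    refine hf.dihedralAngle_eq hij hfac ?_ (by simp) (by simp) hri hrj hi4.symm hj4.symm ?_
      (triangle_subset_halfPlane v i j 4)
    · intro h
      have h4 : (4 : Fin 5) ∈ ({i, j, r, t} : Finset (Fin 5)) := by rw [h]; simp
      rw [hset] at h4
      revert h4; decide
    · intro k hk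
      by_cases hkt : k = t
      · exact ⟨1, 1, zero_le_one, by rw [hkt, ht]; module⟩
      · refine triangle_subset_halfPlane v i j r k ?_
        simp only [Finset.mem_insert, Finset.mem_singleton] at hk ⊢
        tauto
  have lateral : ∀ i r s : Fin 5, {i, 4} ∈ pyramidEdges →
      pyramidFacets.filter ({i, 4} ⊆ ·) = {{i, 4, r}, {i, 4, s}} →
      ({i, 4, r} : Finset (Fin 5)) ≠ {i, 4, s} → r ≠ i → r ≠ 4 → s ≠ i → s ≠ 4 →
      dihedralAngle (convexHull ℝ (range v)) (face v {i, 4}) =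
        hingeAngle (v i) (v 4) (v r) (v s) := by
    intro i r s hi hfac hne h1 h2 h3 h4
    exact hf.dihedralAngle_eq hi hfac hne (by simp) (by simp) h1 h2 h3 h4
      (triangle_subset_halfPlane v i 4 r) (triangle_subset_halfPlane v i 4 s)
  rw [hf.dehn_eq_sum, pyramidEdges]
  rw [Finset.sum_insert (by decide), Finset.sum_insert (by decide), Finset.sum_insert (by decide),
    Finset.sum_insert (by decide), Finset.sum_insert (by decide), Finset.sum_insert (by decide),
    Finset.sum_insert (by decide), Finset.sum_singleton]
  simp only [diam_face_pair]
  rw [base 0 1 3 2 (by decide) h2 (by decide) (by decide) (by decide) (by decide) (by decide)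
      (by decide),
    base 1 2 0 3 (by decide) (by rw [h2]; abel) (by decide) (by decide) (by decide) (by decide)
      (by decide) (by decide),
    base 2 3 1 0 (by decide) (by rw [h2]; abel) (by decide) (by decide) (by decide) (by decide)
      (by decide) (by decide),
    base 3 0 2 1 (by decide) (by rw [h2]; abel) (by decide) (by decide) (by decide) (by decide)
      (by decide) (by decide),
    lateral 0 1 3 (by decide) (by decide) (by decide) (by decide) (by decide) (by decide)
      (by decide),
    lateral 1 0 2 (by decide) (by decide) (by decide) (by decide) (by decide) (by decide)
      (by decide),
    lateral 2 1 3 (by decide) (by decide) (by decide) (by decide) (by decide) (by decide)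
      (by decide),
    lateral 3 2 0 (by decide) (by decide) (by decide) (by decide) (by decide) (by decide)
      (by decide)]
  abel

end Pyramid

end

/-! ### Relations in ℝ ⊗ ℝ/πℤ -/

noncomputable section

open Real

/-- The first factor is divisible: move n from x = n(x/n) across the tensor sign, where it kills θ.
-/
theorem tmul_eq_zero_of_mul_eq (x : ℝ) {θ : ℝ} (n : ℕ) (k : ℤ) (hn : n ≠ 0) (h : n * θ = k * π) :
    x ⊗ₜ[ℤ] (θ : AddCircle π) = 0 := by
  have hx : x = n • (x / n) := by
    rw [nsmul_eq_mul]; field_simp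
  have hθ : n • (θ : AddCircle π) = 0 := by
    rw [← AddCircle.coe_nsmul, nsmul_eq_mul, h, ← zsmul_eq_mul, AddCircle.coe_zsmul,
      AddCircle.coe_period, smul_zero]
  rw [hx, TensorProduct.smul_tmul, hθ, TensorProduct.tmul_zero]

/-- A `ℚ`-linear functional on the lengths maps a relation in `ℝ ⊗ ℝ/πℤ` to a rational relation
between the angles and `π`. -/
theorem exists_rat_of_tmul_add_tmul_eq_zero {a b x y : ℝ}
    (h : a ⊗ₜ[ℤ] (x : AddCircle π) + b ⊗ₜ[ℤ] (y : AddCircle π) = 0) (f : ℝ →ₗ[ℚ] ℚ) :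
    ∃ s : ℚ, f a * x + f b * y = s * π := by
  -- Passing from ℝ/πℤ to ℝ/πℚ makes the second factor a ℚ-space, so that `f u • g w` is defined and
  -- ℤ-bilinear.
  let Q : Submodule ℚ ℝ := Submodule.span ℚ {π}
  let g : AddCircle π →+ ℝ ⧸ Q := QuotientAddGroup.lift (AddSubgroup.zmultiples π)
    Q.mkQ.toAddMonoidHom (by
      rw [AddSubgroup.zmultiples_le, AddMonoidHom.mem_ker]
      exact (Submodule.Quotient.mk_eq_zero Q).2 (Submodule.mem_span_singleton_self π))
  have hg : ∀ z : ℝ, g (z : AddCircle π) = Q.mkQ z := fun z => rfl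
  let F : ℝ →+ AddCircle π →+ ℝ ⧸ Q :=
    ((smulAddHom ℚ (ℝ ⧸ Q)).comp f.toAddMonoidHom).compl₂ g
  have hF : ∀ u w, F u w = f u • g w := fun u w => rfl
  have h' := congrArg (TensorProduct.liftAddHom F (fun r m n => by
    rw [hF, hF, map_zsmul, map_zsmul, smul_assoc, smul_comm])) h
  rw [map_add, TensorProduct.liftAddHom_tmul, TensorProduct.liftAddHom_tmul, map_zero, hF, hF,
    hg, hg, ← map_smul, ← map_smul, ← map_add, Submodule.mkQ_apply, Submodule.Quotient.mk_eq_zero,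
    Submodule.mem_span_singleton] at h'
  obtain ⟨s, hs⟩ := h'
  refine ⟨s, ?_⟩
  simpa [Rat.smul_def] using hs.symm

/-- If the lengths are ℚ-independent, functionals killing one length but not the other isolate each
angle. If they are proportional over ℚ, a functional nonzero at `a` gives a single combined
relation. -/
theorem rational_angles_or_rational_ratio {a b x y : ℝ} (ha : a ≠ 0)
    (h : a ⊗ₜ[ℤ] (x : AddCircle π) + b ⊗ₜ[ℤ] (y : AddCircle π) = 0) :
    ((∃ s : ℚ, x = s * π) ∧ ∃ s : ℚ, y = s * π) ∨
      ∃ r : ℚ, b = r * a ∧ ∃ s : ℚ, x + r * y = s * π := by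
  have key := exists_rat_of_tmul_add_tmul_eq_zero h
  by_cases hab : b ∈ Submodule.span ℚ {a}
  · right
    obtain ⟨r, hr⟩ := Submodule.mem_span_singleton.1 hab
    refine ⟨r, by rw [← hr, Rat.smul_def], ?_⟩
    obtain ⟨f, hf, -⟩ := Submodule.exists_le_ker_of_notMem (p := (⊥ : Submodule ℚ ℝ)) (v := a) ha
    obtain ⟨s, hs⟩ := key f
    refine ⟨s / f a, ?_⟩
    rw [← hr, map_smul, smul_eq_mul] at hs
    have hf' : (f a : ℝ) ≠ 0 := by exact_mod_cast hf
    push_cast at hs ⊢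
    field_simp
    linear_combination hs
  · left
    have hba : a ∉ Submodule.span ℚ {b} := by
      intro hmem
      obtain ⟨r, hr⟩ := Submodule.mem_span_singleton.1 hmem
      have hr0 : r ≠ 0 := by rintro rfl; simp at hr; exact ha hr.symm
      exact hab (Submodule.mem_span_singleton.2 ⟨r⁻¹, by rw [← hr, inv_smul_smul₀ hr0]⟩)
    constructor
    · obtain ⟨f, hf, hker⟩ := Submodule.exists_le_ker_of_notMem hba
      have hfb : f b = 0 := hker (Submodule.mem_span_singleton_self b)
      obtain ⟨s, hs⟩ := key f
      have hf' : (f a : ℝ) ≠ 0 := by exact_mod_cast hf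
      refine ⟨s / f a, ?_⟩
      rw [hfb] at hs
      push_cast at hs ⊢
      field_simp
      linear_combination hs
    · obtain ⟨f, hf, hker⟩ := Submodule.exists_le_ker_of_notMem hab
      have hfa : f a = 0 := hker (Submodule.mem_span_singleton_self a)
      obtain ⟨s, hs⟩ := key f
      have hf' : (f b : ℝ) ≠ 0 := by exact_mod_cast hf
      refine ⟨s / f b, ?_⟩
      rw [hfa] at hs
      push_cast at hs ⊢
      field_simp
      linear_combination hs

/-! ### Both angles rational: Kronecker's theorem -/

/-- If `u`, `v` are roots of unity with `2 (u + u⁻¹) + (v + v⁻¹) = -2`, then `u + u⁻¹ + 1` vanishes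
or is itself a root of unity. -/
theorem rootOfUnity_relation {u v : ℂ} {m n : ℕ} (hm : 0 < m) (hn : 0 < n) (hu : u ^ m = 1)
    (hv : v ^ n = 1) (h : 2 * (u + u⁻¹) + (v + v⁻¹) = -2) :
    u + u⁻¹ + 1 = 0 ∨ ∃ k : ℕ, 0 < k ∧ (u + u⁻¹ + 1) ^ k = 1 := by
  have hui : IsIntegral ℤ u := .of_pow hm (hu ▸ isIntegral_one)
  have hvi : IsIntegral ℤ v := .of_pow hn (hv ▸ isIntegral_one)
  have huinv : IsIntegral ℤ u⁻¹ := .of_pow hm (by rw [inv_pow, hu, inv_one]; exact isIntegral_one)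
  let K := IntermediateField.adjoin ℚ {u, v}
  have : FiniteDimensional ℚ K := by
    refine IntermediateField.finiteDimensional_adjoin ?_
    rintro z (rfl | rfl)
    · exact hui.tower_top
    · exact hvi.tower_top
  have : NumberField K := ⟨⟩
  let U : K := ⟨u, IntermediateField.subset_adjoin ℚ _ (by simp)⟩
  let V : K := ⟨v, IntermediateField.subset_adjoin ℚ _ (by simp)⟩
  have hU : U ^ m = 1 := Subtype.ext hu
  have hV : V ^ n = 1 := Subtype.ext hv
  have hUV : 2 * (U + U⁻¹) + (V + V⁻¹) = -2 := Subtype.ext h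
  by_cases h0 : u + u⁻¹ + 1 = 0
  · exact Or.inl h0
  right
  have hX0 : U + U⁻¹ + 1 ≠ 0 := fun hX => h0 (congrArg Subtype.val hX)
  have hXi : IsIntegral ℤ (U + U⁻¹ + 1) := by
    have : IsIntegral ℤ (algebraMap K ℂ (U + U⁻¹ + 1)) := (hui.add huinv).add isIntegral_one
    exact (isIntegral_algebraMap_iff (algebraMap K ℂ).injective).1 this
  -- Integrality comes from the expression in `u`, the bound on conjugates from the one in `v`:
  -- every embedding sends V to the unit circle, so -(V + V⁻¹)/2 has absolute value at most 1.
  obtain ⟨k, hk, hpow⟩ := NumberField.Embeddings.pow_eq_one_of_norm_le_one K ℂ hX0 hXi (by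
    intro φ
    have hφ : ‖φ V‖ = 1 := Complex.norm_eq_one_of_pow_eq_one (n := n)
      (by rw [← map_pow, hV, map_one]) hn.ne'
    have hX : U + U⁻¹ + 1 = -(V + V⁻¹) / 2 := by linear_combination hUV / 2
    rw [hX, map_div₀, map_neg, map_add, map_inv₀, norm_div, norm_neg]
    have := norm_add_le (φ V) (φ V)⁻¹
    rw [norm_inv, hφ] at this
    simp only [map_ofNat, Complex.norm_ofNat]
    linarith)
  exact ⟨k, hk, congrArg Subtype.val hpow⟩

/-- With u = exp(ix) the quantity u + u⁻¹ + 1 = 2 cos x + 1 is real, so being zero or a root of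
unity leaves only 0, 1 and -1. -/
theorem two_cos_add_one_of_rational {x y : ℝ} (hx : ∃ s : ℚ, x = s * π) (hy : ∃ s : ℚ, y = s * π)
    (h : 2 * cos x + cos y = -1) : cos x = -1 ∨ cos x = -1 / 2 ∨ cos x = 0 := by
  obtain ⟨r, rfl⟩ := hx
  obtain ⟨s, rfl⟩ := hy
  have root : ∀ q : ℚ, Complex.exp ((q * π : ℝ) * Complex.I) ^ (2 * q.den) = 1 := by
    intro q
    rw [← Complex.exp_nat_mul, Complex.exp_eq_one_iff]
    refine ⟨q.num, ?_⟩
    have : (q * q.den : ℂ) = q.num := by exact_mod_cast Rat.mul_den_eq_num q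
    push_cast
    linear_combination 2 * π * Complex.I * this
  have hcos : ∀ z : ℝ, Complex.exp (z * Complex.I) + (Complex.exp (z * Complex.I))⁻¹ =
      ((2 * cos z : ℝ) : ℂ) := by
    intro z
    rw [← Complex.exp_neg, ← neg_mul, ← Complex.two_cos]
    push_cast
    ring
  have hrel := rootOfUnity_relation (Nat.mul_pos two_pos r.den_pos) (Nat.mul_pos two_pos s.den_pos)
    (root r) (root s) (by
      have h' : 2 * (2 * cos (r * π)) + 2 * cos (s * π) = -2 := by linarith
      rw [hcos, hcos]
      exact_mod_cast congrArg Complex.ofReal h')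
  rw [hcos] at hrel
  norm_cast at hrel
  rcases hrel with h0 | ⟨k, hk, hpow⟩
  · right; left; linarith
  · rcases (pow_eq_one_iff_cases.1 hpow) with h1 | h1 | ⟨h1, -⟩
    · omega
    · right; right; linarith
    · left; linarith


/-! ### Rational ratio of lengths: an identity in an imaginary quadratic order -/

/-- The hypotheses say q + ti = R exp(ix) and t + pi = √2 R exp(iy). Raising to powers that make
exp(i(qx + py)) trivial eliminates both exponentials, leaving a relation between quadratic integers.
-/
theorem pow_relation_of_rational {p q : ℕ} (hqp : q ≤ p) {R t x y : ℝ}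
    (hcx : R * cos x = q) (hsx : R * sin x = t) (hcy : √2 * R * cos y = t)
    (hsy : √2 * R * sin y = p) (hrat : ∃ s : ℚ, q * x + p * y = s * π) :
    ∃ N : ℕ, 0 < N ∧ (p - t * Complex.I) ^ (2 * p * N) =
      (q - t * Complex.I) ^ (2 * q * N) * 2 ^ (p * N) * ((R : ℂ) ^ 2) ^ ((p - q) * N) := by
  obtain ⟨s, hs⟩ := hrat
  refine ⟨2 * s.den, by have := s.den_pos; omega, ?_⟩
  set N := 2 * s.den with hN
  set E := Complex.exp (x * Complex.I) with hE
  set F := Complex.exp (y * Complex.I) with hF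
  have hE0 : E ≠ 0 := Complex.exp_ne_zero _
  have hEF : E ^ (2 * q * N) * F ^ (2 * p * N) = 1 := by
    rw [hE, hF, ← Complex.exp_nat_mul, ← Complex.exp_nat_mul, ← Complex.exp_add,
      Complex.exp_eq_one_iff]
    refine ⟨2 * s.num, ?_⟩
    have h1 : (s * s.den : ℂ) = s.num := by exact_mod_cast Rat.mul_den_eq_num s
    have h2 : (q * x + p * y : ℂ) = s * π := by exact_mod_cast congrArg Complex.ofReal hs
    rw [hN]
    push_cast
    linear_combination 4 * s.den * Complex.I * h2 + 4 * π * Complex.I * h1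
  have hcx' : (R * Complex.cos x : ℂ) = q := by exact_mod_cast congrArg Complex.ofReal hcx
  have hsx' : (R * Complex.sin x : ℂ) = t := by exact_mod_cast congrArg Complex.ofReal hsx
  have hcy' : (√2 * R * Complex.cos y : ℂ) = t := by exact_mod_cast congrArg Complex.ofReal hcy
  have hsy' : (√2 * R * Complex.sin y : ℂ) = p := by exact_mod_cast congrArg Complex.ofReal hsy
  have h2 : ((√2 : ℝ) : ℂ) ^ 2 = 2 := by
    exact_mod_cast congrArg Complex.ofReal (Real.sq_sqrt (show (0 : ℝ) ≤ 2 by norm_num))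
  have hq : (q - t * Complex.I : ℂ) * E = R := by
    rw [hE, Complex.exp_mul_I, ← hcx', ← hsx']
    linear_combination (R : ℂ) * Complex.sin_sq_add_cos_sq (x : ℂ)
      - R * Complex.sin x ^ 2 * Complex.I_sq
  have hp : (p - t * Complex.I : ℂ) ^ 2 = -(2 * (R : ℂ) ^ 2 * F ^ 2) := by
    have : (p - t * Complex.I : ℂ) = -Complex.I * (√2 * R * F) := by
      rw [hF, Complex.exp_mul_I, ← hcy', ← hsy']
      linear_combination (√2 * R * Complex.sin y : ℂ) * Complex.I_sq
    rw [this]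
    linear_combination (√2 * R * F : ℂ) ^ 2 * Complex.I_sq - R ^ 2 * F ^ 2 * h2
  -- The factor 2 in N removes the sign in (p - ti)² = -2R²F².
  have heven : Even (p * N) := ⟨p * s.den, by rw [hN]; ring⟩
  have hq' : (q - t * Complex.I : ℂ) ^ (2 * q * N) * E ^ (2 * q * N) = ((R : ℂ) ^ 2) ^ (q * N) := by
    rw [← mul_pow, hq]; ring
  apply mul_right_cancel₀ (pow_ne_zero (2 * q * N) hE0)
  have hexp : p * N = q * N + (p - q) * N := by rw [← add_mul]; congr 1; omega
  calc (p - t * Complex.I : ℂ) ^ (2 * p * N) * E ^ (2 * q * N)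
      = (2 * (R : ℂ) ^ 2) ^ (p * N) * (E ^ (2 * q * N) * F ^ (2 * p * N)) := by
        rw [show 2 * p * N = 2 * (p * N) by ring, pow_mul, hp, heven.neg_pow, mul_pow, pow_mul F]
        ring
    _ = 2 ^ (p * N) * (((R : ℂ) ^ 2) ^ (q * N) * ((R : ℂ) ^ 2) ^ ((p - q) * N)) := by
        rw [hEF, mul_one, mul_pow, ← pow_add, ← hexp]
    _ = _ := by rw [← hq']; ring

theorem eq_two_of_prime_dvd {p q : ℕ} (hqp : q < p) (hcop : p.Coprime q) {t : ℝ}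
    (ht : t ^ 2 = p ^ 2 - 2 * q ^ 2) (hpos : 2 * q ^ 2 < p ^ 2) {N : ℕ} (hN : 0 < N)
    (h : (p - t * Complex.I) ^ (2 * p * N) = (q - t * Complex.I) ^ (2 * q * N) * 2 ^ (p * N) *
      ((p : ℂ) ^ 2 - q ^ 2) ^ ((p - q) * N))
    {l : ℕ} (hl : l.Prime) (hdvd : l ∣ p ^ 2 - q ^ 2) : l = 2 := by
  set D : ℤ := 2 * q ^ 2 - p ^ 2 with hD
  have hDneg : D < 0 := by
    have : (2 * q ^ 2 : ℤ) < p ^ 2 := by exact_mod_cast hpos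
    omega
  have hW : (-(t * Complex.I)) * (-(t * Complex.I)) = ((D : ℤ) : ℂ) := by
    have : (t : ℂ) ^ 2 = p ^ 2 - 2 * q ^ 2 := by exact_mod_cast congrArg Complex.ofReal ht
    rw [hD]
    push_cast
    linear_combination (t : ℂ) ^ 2 * Complex.I_sq - this
  -- Since D is negative it is not a square, so the identity in ℂ descends to ℤ[√D].
  have hinj := Zsqrtd.lift_injective (⟨_, hW⟩ : {r : ℂ // r * r = (D : ℂ)})
    (fun n hn => by have := mul_self_nonneg n; omega)
  have hrel : (⟨p, 1⟩ : ℤ√D) ^ (2 * p * N) = ⟨q, 1⟩ ^ (2 * q * N) * 2 ^ (p * N) *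
      ((p : ℤ√D) ^ 2 - (q : ℤ√D) ^ 2) ^ ((p - q) * N) := by
    apply hinj
    simp only [map_mul, map_pow, map_sub, map_natCast, map_ofNat, Zsqrtd.lift_apply_apply]
    push_cast
    rw [one_mul, ← sub_eq_add_neg, ← sub_eq_add_neg, h]
  have : Fact l.Prime := ⟨hl⟩
  have hm : ((p : ZMod l) ^ 2 - (q : ZMod l) ^ 2) = 0 := by
    have h1 := (ZMod.natCast_eq_zero_iff (p ^ 2 - q ^ 2) l).2 hdvd
    rw [Nat.cast_sub (Nat.pow_le_pow_left hqp.le 2)] at h1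
    exact_mod_cast h1
  -- Modulo l we have p² = q², so D = 2q² - p² becomes p² and √D may be sent to p. Then p + √D maps
  -- to 2p while the factor p² - q² on the other side maps to 0, so l divides 2p.
  have hWl : (p : ZMod l) * p = ((D : ℤ) : ZMod l) := by
    rw [hD]; push_cast; linear_combination 2 * hm
  have hl' := congrArg (Zsqrtd.lift (⟨_, hWl⟩ : {r : ZMod l // r * r = (D : ZMod l)})) hrel
  simp only [map_mul, map_pow, map_sub, map_natCast, map_ofNat, Zsqrtd.lift_apply_apply, hm] at hl'
  rw [zero_pow (Nat.mul_pos (by omega) hN).ne', mul_zero] at hl'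
  have h2p : ((2 * p : ℕ) : ZMod l) = 0 := by
    have := eq_zero_of_pow_eq_zero hl'
    push_cast at this ⊢
    linear_combination this
  rw [ZMod.natCast_eq_zero_iff] at h2p
  rcases hl.dvd_mul.1 h2p with h2 | h2
  · exact (Nat.prime_dvd_prime_iff_eq hl Nat.prime_two).1 h2
  · exfalso
    have hq2 : l ∣ q ^ 2 :=
      (Nat.dvd_sub_iff_right (Nat.pow_le_pow_left hqp.le 2) (dvd_pow h2 two_ne_zero)).1 hdvd
    exact Nat.not_coprime_of_dvd_of_dvd hl.one_lt h2 (hl.dvd_of_dvd_pow hq2) hcop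

/-- Both p - q and p + q are powers of 2. Parity and coprimality force p - q = 2, and then 2q² < p²
bounds q. -/
theorem eq_of_sq_sub_sq_eq_two_pow {p q k : ℕ} (hq : 0 < q) (hcop : p.Coprime q)
    (hpos : 2 * q ^ 2 < p ^ 2) (hk : p ^ 2 - q ^ 2 = 2 ^ k) : (p = 3 ∧ q = 1) ∨ (p = 5 ∧ q = 3) := by
  have hqp : q < p := by nlinarith
  rw [Nat.sq_sub_sq] at hk
  obtain ⟨a, -, ha⟩ := (Nat.dvd_prime_pow Nat.prime_two).1 (hk ▸ Dvd.intro_left _ rfl : p - q ∣ 2 ^ k)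
  obtain ⟨b, -, hb⟩ := (Nat.dvd_prime_pow Nat.prime_two).1 (hk ▸ Dvd.intro _ rfl : p + q ∣ 2 ^ k)
  have hab : a < b := by
    rw [← Nat.pow_lt_pow_iff_right (a := 2) (by norm_num)]; omega
  have ha1 : a = 1 := by
    rcases Nat.lt_trichotomy a 1 with h | h | h
    · obtain rfl : a = 0 := by omega
      obtain ⟨c, rfl⟩ : ∃ c, b = c + 1 := ⟨b - 1, by omega⟩
      rw [pow_succ] at hb
      omega
    · exact h
    · exfalso
      obtain ⟨c, rfl⟩ : ∃ c, a = c + 2 := ⟨a - 2, by omega⟩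
      obtain ⟨d, rfl⟩ : ∃ d, b = d + 2 := ⟨b - 2, by omega⟩
      rw [pow_add] at ha hb
      exact Nat.not_coprime_of_dvd_of_dvd (d := 2) (by norm_num) (by omega) (by omega) hcop
  subst ha1
  obtain rfl : p = q + 2 := by omega
  have hq4 : q ≤ 4 := by nlinarith
  interval_cases q
  · simp
  · revert hcop; decide
  · simp
  · revert hcop; decide

theorem cos_add_of_sqrt_seven {x y a b c d t : ℝ} (ht : t ^ 2 = 7) (hx : cos x = a)
    (hx' : sin x = b * t) (hy : cos y = c) (hy' : sin y = d * t) :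
    cos (x + y) = a * c - 7 * (b * d) ∧ sin (x + y) = (a * d + b * c) * t := by
  rw [cos_add, sin_add, hx, hx', hy, hy']
  constructor
  · linear_combination -(b * d) * ht
  · ring

/-- Cosines stay in ℚ and sines in ℚ√7 under addition, so the cosine of the combined angle is an
explicit rational. Niven's theorem allows only 0, ±1/2 and ±1, and 87/256 is none of these. -/
theorem not_rational_one_three {t x y : ℝ} (ht : t ^ 2 = 7) (hx : cos x = -3 / 4)
    (hx' : sin x = 1 / 4 * t) (hy : cos y = -1 / 8) (hy' : sin y = 3 / 8 * t) :
    ¬ ∃ s : ℚ, x + 3 * y = s * π := by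
  intro hs
  obtain ⟨h1, k1⟩ := cos_add_of_sqrt_seven ht hx hx' hy hy'
  obtain ⟨h2, k2⟩ := cos_add_of_sqrt_seven ht h1 k1 hy hy'
  obtain ⟨h3, -⟩ := cos_add_of_sqrt_seven ht h2 k2 hy hy'
  rw [show x + y + y + y = x + 3 * y by ring] at h3
  have := niven hs ⟨87 / 256, by rw [h3]; norm_num⟩
  rw [h3] at this
  norm_num at this

theorem not_rational_three_five {t x y : ℝ} (ht : t ^ 2 = 7) (hx : cos x = 1 / 8)
    (hx' : sin x = 3 / 8 * t) (hy : cos y = -9 / 16) (hy' : sin y = 5 / 16 * t) :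
    ¬ ∃ s : ℚ, 3 * x + 5 * y = s * π := by
  intro hs
  obtain ⟨h1, k1⟩ := cos_add_of_sqrt_seven ht hx hx' hx hx'
  obtain ⟨h2, k2⟩ := cos_add_of_sqrt_seven ht h1 k1 hx hx'
  obtain ⟨h3, k3⟩ := cos_add_of_sqrt_seven ht h2 k2 hy hy'
  obtain ⟨h4, k4⟩ := cos_add_of_sqrt_seven ht h3 k3 hy hy'
  obtain ⟨h5, k5⟩ := cos_add_of_sqrt_seven ht h4 k4 hy hy'
  obtain ⟨h6, k6⟩ := cos_add_of_sqrt_seven ht h5 k5 hy hy'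
  obtain ⟨h7, -⟩ := cos_add_of_sqrt_seven ht h6 k6 hy hy'
  clear h1 h2 h3 h4 h5 h6 k1 k2 k3 k4 k5 k6
  rw [show x + x + x + y + y + y + y + y = 3 * x + 5 * y by ring] at h7
  norm_num at h7
  have := niven hs ⟨-(3617721 / 4194304), by rw [h7]; norm_num⟩
  rw [h7] at this
  norm_num at this

/-! ### The angles α and β, and when the tensor vanishes -/

/-- The dihedral angle of the pyramid over the square with vertices `±1, ±i` and apex `(0, 0, h)`
along an edge of the base. -/
def baseAngle (h : ℝ) : ℝ := arccos (1 / √(1 + 2 * h ^ 2))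

/-- Half the dihedral angle of the pyramid over the square with vertices `±1, ±i` and apex
`(0, 0, h)` along an edge through the apex. -/
def apexAngle (h : ℝ) : ℝ := arccos (h / √(1 + 2 * h ^ 2))

section Angles

variable {h : ℝ}

theorem cos_baseAngle (h : ℝ) : √(1 + 2 * h ^ 2) * cos (baseAngle h) = 1 := by
  have hc : 0 < √(1 + 2 * h ^ 2) := Real.sqrt_pos.2 (by positivity)
  have h1 : 1 ≤ √(1 + 2 * h ^ 2) := Real.one_le_sqrt.2 (by nlinarith [sq_nonneg h])
  rw [baseAngle, cos_arccos]
  · field_simp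
  · exact le_trans (by norm_num) (by positivity : (0 : ℝ) ≤ 1 / √(1 + 2 * h ^ 2))
  · rw [div_le_one hc]; exact h1

theorem cos_apexAngle (hh : 0 < h) : √(1 + 2 * h ^ 2) * cos (apexAngle h) = h := by
  have hc : 0 < √(1 + 2 * h ^ 2) := Real.sqrt_pos.2 (by positivity)
  rw [apexAngle, cos_arccos]
  · field_simp
  · exact le_trans (by norm_num) (by positivity : (0 : ℝ) ≤ h / √(1 + 2 * h ^ 2))
  · rw [div_le_one hc]; exact Real.le_sqrt_of_sq_le (by nlinarith [sq_nonneg h])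

theorem sin_baseAngle (hh : 0 < h) : √(1 + 2 * h ^ 2) * sin (baseAngle h) = √2 * h := by
  have hc2 : √(1 + 2 * h ^ 2) ^ 2 = 1 + 2 * h ^ 2 := Real.sq_sqrt (by positivity)
  have hs : 0 ≤ sin (baseAngle h) := sin_nonneg_of_nonneg_of_le_pi (arccos_nonneg _) (arccos_le_pi _)
  have h2 : √2 ^ 2 = 2 := Real.sq_sqrt (by norm_num)
  have h1 := cos_baseAngle h
  rw [← sq_eq_sq₀ (by positivity) (by positivity)]
  linear_combination √(1 + 2 * h ^ 2) ^ 2 * sin_sq_add_cos_sq (baseAngle h) + hc2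
    - (√(1 + 2 * h ^ 2) * cos (baseAngle h) + 1) * h1 - h ^ 2 * h2

theorem sin_apexAngle (hh : 0 < h) : √(1 + 2 * h ^ 2) * sin (apexAngle h) = √(1 + h ^ 2) := by
  have hc2 : √(1 + 2 * h ^ 2) ^ 2 = 1 + 2 * h ^ 2 := Real.sq_sqrt (by positivity)
  have hs : 0 ≤ sin (apexAngle h) := sin_nonneg_of_nonneg_of_le_pi (arccos_nonneg _) (arccos_le_pi _)
  have h2 : √(1 + h ^ 2) ^ 2 = 1 + h ^ 2 := Real.sq_sqrt (by positivity)
  have h1 := cos_apexAngle hh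
  rw [← sq_eq_sq₀ (by positivity) (by positivity)]
  linear_combination √(1 + 2 * h ^ 2) ^ 2 * sin_sq_add_cos_sq (apexAngle h) + hc2
    - (√(1 + 2 * h ^ 2) * cos (apexAngle h) + h) * h1 - h2

theorem irrational_ratio_of_angle_relation (hh : 0 < h) {r s : ℚ}
    (hr : √(1 + h ^ 2) = r * (1 / √2)) (hs : baseAngle h + r * apexAngle h = s * π) : False := by
  have h2 : √2 ^ 2 = 2 := Real.sq_sqrt (by norm_num)
  have hH2 : √(1 + h ^ 2) ^ 2 = 1 + h ^ 2 := Real.sq_sqrt (by positivity)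
  have hc0 : 0 < √(1 + 2 * h ^ 2) := Real.sqrt_pos.2 (by positivity)
  have hH0 : 0 < √(1 + h ^ 2) := Real.sqrt_pos.2 (by positivity)
  have hc2 : √(1 + 2 * h ^ 2) ^ 2 = 1 + 2 * h ^ 2 := Real.sq_sqrt (by positivity)
  have hca := cos_baseAngle h
  have hsa := sin_baseAngle hh
  have hcb := cos_apexAngle hh
  have hsb := sin_apexAngle hh
  set c := √(1 + 2 * h ^ 2)
  set H := √(1 + h ^ 2)
  set α := baseAngle h
  set β := apexAngle h
  have hrH : √2 * H = r := by rw [hr]; field_simp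
  have hrpos : 0 < r := by
    have : (0 : ℝ) < r := by rw [← hrH]; positivity
    exact_mod_cast this
  obtain ⟨p, q, hq, hcop, hrpq⟩ : ∃ p q : ℕ, 0 < q ∧ p.Coprime q ∧ r = p / q := by
    refine ⟨r.num.natAbs, r.den, r.den_pos, r.reduced, ?_⟩
    have : ((r.num.natAbs : ℤ) : ℚ) = r.num := by
      rw [Int.natCast_natAbs, abs_of_pos (Rat.num_pos.2 hrpos)]
    rw [← Int.cast_natCast (r.num.natAbs), this, Rat.num_div_den]
  have hq' : (0 : ℝ) < q := by exact_mod_cast hq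
  have hrq : (r : ℝ) * q = p := by
    rw [hrpq]; push_cast; field_simp
  have hr2 : (r : ℝ) ^ 2 = 2 + 2 * h ^ 2 := by
    rw [← hrH]; linear_combination H ^ 2 * h2 + 2 * hH2
  have hp2 : (p : ℝ) ^ 2 = (2 + 2 * h ^ 2) * q ^ 2 := by
    rw [← hrq]; linear_combination (q : ℝ) ^ 2 * hr2
  have hlt : 2 * q ^ 2 < p ^ 2 := by
    have : (2 * q ^ 2 : ℝ) < p ^ 2 := by
      have : 0 < h ^ 2 * (q : ℝ) ^ 2 := by positivity
      rw [hp2]; linarith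
    exact_mod_cast this
  have hqp : q < p := by nlinarith
  -- Clear the denominator of r = p/q. The data for the power relation are R = qc and t = √2hq, with
  -- R² = p² - q² and t² = p² - 2q².
  have hrat : ∃ s : ℚ, q * α + p * β = s * π :=
    ⟨q * s, by push_cast; linear_combination (q : ℝ) * hs - β * hrq⟩
  obtain ⟨N, hN, hrel⟩ := pow_relation_of_rational (R := q * c) (t := √2 * h * q) hqp.le
    (by linear_combination (q : ℝ) * hca) (by linear_combination (q : ℝ) * hsa)
    (by linear_combination √2 * (q : ℝ) * hcb)
    (by linear_combination √2 * (q : ℝ) * hsb + (q : ℝ) * hrH + hrq) hrat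
  have hm : ((q * c : ℝ) : ℂ) ^ 2 = (p : ℂ) ^ 2 - q ^ 2 := by
    have : (q * c : ℝ) ^ 2 = (p : ℝ) ^ 2 - q ^ 2 := by
      rw [hp2, mul_pow, hc2]; ring
    exact_mod_cast congrArg Complex.ofReal this
  rw [hm] at hrel
  have hne : p ^ 2 - q ^ 2 ≠ 0 := by omega
  have hpow := Nat.eq_prime_pow_of_unique_prime_dvd hne (p := 2) (fun {l} hl hdvd =>
    eq_two_of_prime_dvd hqp hcop
      (by linear_combination (h * (q : ℝ)) ^ 2 * h2 - hp2) hlt hN hrel hl hdvd)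
  have hcc : c * c = 1 + 2 * h ^ 2 := by rw [← sq, hc2]
  -- Doubling the angles removes the square root c: the cosines become rational and, in the two
  -- remaining cases, the sines become rational multiples of √7.
  have hca2 : c ^ 2 * cos (2 * α) = 2 - c ^ 2 := by
    rw [cos_two_mul]; linear_combination 2 * (c * cos α + 1) * hca
  have hsa2 : c ^ 2 * sin (2 * α) = 2 * (√2 * h) := by
    rw [sin_two_mul]; linear_combination 2 * c * cos α * hsa + 2 * (√2 * h) * hca
  have hcb2 : c ^ 2 * cos (2 * β) = 2 * h ^ 2 - c ^ 2 := by
    rw [cos_two_mul]; linear_combination 2 * (c * cos β + h) * hcb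
  have hsb2 : c ^ 2 * sin (2 * β) = √2 * h * r := by
    rw [sin_two_mul]
    linear_combination 2 * c * cos β * hsb + 2 * H * hcb - h * H * h2 + √2 * h * hrH
  rw [hc2] at hca2 hsa2 hcb2 hsb2
  obtain ⟨s', hs'⟩ := hrat
  rcases eq_of_sq_sub_sq_eq_two_pow hq hcop hlt hpow with ⟨rfl, rfl⟩ | ⟨rfl, rfl⟩
  · have hr3 : (r : ℝ) = 3 := by rw [hrpq]; norm_num
    have hh2 : h ^ 2 = 7 / 2 := by rw [hr3] at hr2; linarith
    rw [hh2] at hca2 hsa2 hcb2 hsb2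
    rw [hr3] at hsb2
    refine not_rational_one_three (t := √2 * h) (x := 2 * α) (y := 2 * β) ?_ ?_ ?_ ?_ ?_
      ⟨2 * s', ?_⟩
    · rw [mul_pow, h2, hh2]; norm_num
    · linarith
    · linarith
    · linarith
    · linarith
    · push_cast at hs' ⊢; linarith
  · have hr3 : (r : ℝ) = 5 / 3 := by rw [hrpq]; norm_num
    have hh2 : h ^ 2 = 7 / 18 := by rw [hr3] at hr2; linarith
    rw [hh2] at hca2 hsa2 hcb2 hsb2
    rw [hr3] at hsb2
    refine not_rational_three_five (t := 3 * (√2 * h)) (x := 2 * α) (y := 2 * β) ?_ ?_ ?_ ?_ ?_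
      ⟨2 * s', ?_⟩
    · rw [mul_pow, mul_pow, h2, hh2]; norm_num
    · linarith
    · linarith
    · linarith
    · linarith
    · push_cast at hs' ⊢; linarith

theorem tmul_baseAngle_add_tmul_apexAngle_eq_zero_iff (hh : 0 < h) :
    (1 / √2) ⊗ₜ[ℤ] (baseAngle h : AddCircle π) + √(1 + h ^ 2) ⊗ₜ[ℤ] (apexAngle h : AddCircle π) = 0 ↔
      h = 1 / √2 := by
  have h2 : √2 ^ 2 = 2 := Real.sq_sqrt (by norm_num)
  have hc2 : √(1 + 2 * h ^ 2) ^ 2 = 1 + 2 * h ^ 2 := Real.sq_sqrt (by positivity)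
  constructor
  · intro hz
    rcases rational_angles_or_rational_ratio (by positivity) hz with
      ⟨⟨s, hs⟩, s', hs'⟩ | ⟨r, hr, s, hs⟩
    · have hca := cos_baseAngle h
      have hcb := cos_apexAngle hh
      have hca2 : (1 + 2 * h ^ 2) * cos (2 * baseAngle h) = 2 - (1 + 2 * h ^ 2) := by
        rw [cos_two_mul, ← hc2]
        linear_combination 2 * (√(1 + 2 * h ^ 2) * cos (baseAngle h) + 1) * hca
      have hcb2 : (1 + 2 * h ^ 2) * cos (2 * apexAngle h) = -1 := by
        rw [cos_two_mul]
        linear_combination 2 * (√(1 + 2 * h ^ 2) * cos (apexAngle h) + h) * hcb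
          - 2 * cos (apexAngle h) ^ 2 * hc2
      have hpos : 0 < 1 + 2 * h ^ 2 := by positivity
      -- Both doubled cosines are rational functions of h²; this is the relation obtained by
      -- eliminating h².
      have hrel : 2 * cos (2 * apexAngle h) + cos (2 * baseAngle h) = -1 := by
        apply mul_left_cancel₀ hpos.ne'
        linear_combination 2 * hcb2 + hca2
      have hh2 : 0 < h ^ 2 := by positivity
      rcases two_cos_add_one_of_rational ⟨2 * s', by push_cast; rw [hs']; ring⟩
        ⟨2 * s, by push_cast; rw [hs]; ring⟩ hrel with h1 | h1 | h1 <;> rw [h1] at hcb2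
      · linarith
      · rw [← sq_eq_sq₀ hh.le (by positivity), div_pow, h2]
        linarith
      · linarith
    · exact (irrational_ratio_of_angle_relation hh hr hs).elim
  · intro hh'
    have hsq : h ^ 2 = 1 / 2 := by rw [hh', div_pow, h2, one_pow]
    have h22 : √(1 + 2 * h ^ 2) = √2 := by rw [hsq]; norm_num
    have ha : baseAngle h = π / 4 := by
      rw [baseAngle, h22, show 1 / √2 = cos (π / 4) by rw [cos_pi_div_four]; field_simp; exact h2.symm]
      exact arccos_cos (by positivity) (by linarith [pi_pos])
    have hb : apexAngle h = π / 3 := by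
      rw [apexAngle, h22, hh', show 1 / √2 / √2 = cos (π / 3) by
        rw [cos_pi_div_three]; field_simp; exact h2.symm]
      exact arccos_cos (by positivity) (by linarith [pi_pos])
    rw [ha, hb, tmul_eq_zero_of_mul_eq _ 4 1 (by norm_num) (by push_cast; ring),
      tmul_eq_zero_of_mul_eq _ 3 1 (by norm_num) (by push_cast; ring), add_zero]

end Angles

end

/-! ### Dihedral angles from Gram determinants, and the orthoscheme -/

noncomputable section

open Real

/-- The Gram determinant of `q - p, r - p` and `q - p, s - p`. -/
def hingeGram (p q r s : E3) : ℝ :=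
  inner ℝ (q - p) (q - p) * inner ℝ (r - p) (s - p) - inner ℝ (q - p) (r - p) * inner ℝ (q - p) (s - p)

theorem inner_perpPart_perpPart_mul (p q r s : E3) :
    inner ℝ (perpPart p q r) (perpPart p q s) * inner ℝ (q - p) (q - p) = hingeGram p q r s := by
  have h := inner_perpPart p q s
  rw [hingeGram]
  conv_lhs => rw [perpPart.eq_def p q r]
  rw [inner_sub_left, inner_smul_left, h, perpPart, inner_sub_right, inner_smul_right,
    real_inner_comm (q - p) (r - p)]
  by_cases hd : q - p = 0
  · simp [hd]
  · have : inner ℝ (q - p) (q - p) ≠ 0 := by rwa [Ne, inner_self_eq_zero]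
    field_simp
    simp

/-- Multiplying by |q - p|² clears the denominators of the projections, so an angle is identified by
polynomial identities in inner products, together with a sign condition when its cosine is nonzero.
-/
theorem cos_hingeAngle_mul_sqrt (p q r s : E3) :
    cos (hingeAngle p q r s) * √(hingeGram p q r r * hingeGram p q s s) = hingeGram p q r s := by
  have h : hingeGram p q r r * hingeGram p q s s =
      (‖perpPart p q r‖ * ‖perpPart p q s‖ * inner ℝ (q - p) (q - p)) ^ 2 := by
    rw [← inner_perpPart_perpPart_mul, ← inner_perpPart_perpPart_mul, real_inner_self_eq_norm_sq,
      real_inner_self_eq_norm_sq (perpPart p q s)]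
    ring
  rw [h, Real.sqrt_sq (mul_nonneg (by positivity) real_inner_self_nonneg), hingeAngle, ← mul_assoc,
    InnerProductGeometry.cos_angle_mul_norm_mul_norm, inner_perpPart_perpPart_mul]

theorem hingeAngle_eq_of_cos_eq {p q r s : E3} {θ : ℝ} (h0 : 0 ≤ θ) (hpi : θ ≤ π)
    (h : cos (hingeAngle p q r s) = cos θ) : hingeAngle p q r s = θ :=
  injOn_cos ⟨InnerProductGeometry.angle_nonneg _ _, InnerProductGeometry.angle_le_pi _ _⟩
    ⟨h0, hpi⟩ h

theorem hingeAngle_eq_pi_div_two {p q r s : E3} (hd : 0 < inner ℝ (q - p) (q - p))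
    (h : hingeGram p q r s = 0) : hingeAngle p q r s = π / 2 := by
  rw [hingeAngle, ← InnerProductGeometry.inner_eq_zero_iff_angle_eq_pi_div_two]
  rw [← inner_perpPart_perpPart_mul] at h
  exact (mul_eq_zero.1 h).resolve_right hd.ne'

theorem hingeAngle_eq_pi_div_four {p q r s : E3} (hC : 0 < hingeGram p q r s)
    (h : hingeGram p q r s ^ 2 * 2 = hingeGram p q r r * hingeGram p q s s) :
    hingeAngle p q r s = π / 4 := by
  have hcos := cos_hingeAngle_mul_sqrt p q r s
  rw [← h, Real.sqrt_mul (sq_nonneg _), Real.sqrt_sq hC.le] at hcos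
  refine hingeAngle_eq_of_cos_eq (by positivity) (by linarith [pi_pos]) ?_
  have h2 : √2 ^ 2 = 2 := Real.sq_sqrt (by norm_num)
  have h2' : 0 < √2 := by positivity
  rw [cos_pi_div_four]
  apply mul_right_cancel₀ (mul_pos hC h2').ne'
  rw [hcos]
  linear_combination -hingeGram p q r s / 2 * h2

theorem hingeAngle_eq_baseAngle {h : ℝ} {p q r s : E3} (hC : 0 < hingeGram p q r s)
    (hAB : hingeGram p q r s ^ 2 * (1 + 2 * h ^ 2) = hingeGram p q r r * hingeGram p q s s) :
    hingeAngle p q r s = baseAngle h := by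
  have hcos := cos_hingeAngle_mul_sqrt p q r s
  rw [← hAB, Real.sqrt_mul (sq_nonneg _), Real.sqrt_sq hC.le] at hcos
  refine hingeAngle_eq_of_cos_eq (arccos_nonneg _) (arccos_le_pi _) ?_
  have hc : 0 < √(1 + 2 * h ^ 2) := Real.sqrt_pos.2 (by positivity)
  apply mul_right_cancel₀ (mul_pos hC hc).ne'
  rw [hcos]
  linear_combination -hingeGram p q r s * cos_baseAngle h

theorem hingeAngle_eq_apexAngle {h : ℝ} (hh : 0 < h) {p q r s : E3} (hC : 0 < hingeGram p q r s)
    (hAB : hingeGram p q r s ^ 2 * (1 + 2 * h ^ 2) =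
      h ^ 2 * (hingeGram p q r r * hingeGram p q s s)) :
    hingeAngle p q r s = apexAngle h := by
  have hcos := cos_hingeAngle_mul_sqrt p q r s
  have hsq := congrArg Real.sqrt hAB
  rw [Real.sqrt_mul (sq_nonneg _), Real.sqrt_sq hC.le, Real.sqrt_mul (sq_nonneg _),
    Real.sqrt_sq hh.le] at hsq
  refine hingeAngle_eq_of_cos_eq (arccos_nonneg _) (arccos_le_pi _) ?_
  have hc : 0 < √(1 + 2 * h ^ 2) := Real.sqrt_pos.2 (by positivity)
  apply mul_right_cancel₀ (mul_pos hC hc).ne'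
  linear_combination h * hcos - hingeGram p q r s * cos_apexAngle hh
    + cos (hingeAngle p q r s) * hsq

theorem apexAngle_le_pi_div_two {h : ℝ} (hh : 0 < h) : apexAngle h ≤ π / 2 := by
  rw [apexAngle, arccos_le_pi_div_two]; positivity

/-- cos 2β = -1/(1 + 2h²) is negative, hence the sign of the Gram determinant; β ≤ π/2 keeps 2β in
the range where cosine is injective. -/
theorem hingeAngle_eq_two_mul_apexAngle {h : ℝ} (hh : 0 < h) {p q r s : E3}
    (hC : 0 < -hingeGram p q r s)
    (hAB : (-hingeGram p q r s) ^ 2 * (1 + 2 * h ^ 2) ^ 2 =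
      hingeGram p q r r * hingeGram p q s s) :
    hingeAngle p q r s = 2 * apexAngle h := by
  have hpos : 0 < 1 + 2 * h ^ 2 := by positivity
  have hcos := cos_hingeAngle_mul_sqrt p q r s
  rw [← hAB, Real.sqrt_mul (sq_nonneg _), Real.sqrt_sq hC.le, Real.sqrt_sq hpos.le] at hcos
  have hnn : 0 ≤ apexAngle h := arccos_nonneg _
  refine hingeAngle_eq_of_cos_eq (by linarith)
    (by linarith [apexAngle_le_pi_div_two hh]) ?_
  have hc2 : √(1 + 2 * h ^ 2) ^ 2 = 1 + 2 * h ^ 2 := Real.sq_sqrt hpos.le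
  have hcb2 : (1 + 2 * h ^ 2) * cos (2 * apexAngle h) = -1 := by
    rw [cos_two_mul]
    linear_combination 2 * (√(1 + 2 * h ^ 2) * cos (apexAngle h) + h) * cos_apexAngle hh
      - 2 * cos (apexAngle h) ^ 2 * hc2
  apply mul_right_cancel₀ (mul_pos hC hpos).ne'
  rw [hcos]
  linear_combination hingeGram p q r s * hcb2

theorem inner_sub_sub_mk (a b c a' b' c' x y z x' y' z' : ℝ) :
    inner ℝ ((!₂[a, b, c] : E3) - !₂[a', b', c']) ((!₂[x, y, z] : E3) - !₂[x', y', z']) =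
      (a - a') * (x - x') + (b - b') * (y - y') + (c - c') * (z - z') := by
  simp [PiLp.inner_apply, Fin.sum_univ_three]
  ring

/-- The value on the orthoscheme of which the Dehn invariants of all the polytopes are multiples. -/
def orthoschemeDehn (h : ℝ) : DehnGroup :=
  (1 / √2) ⊗ₜ[ℤ] (baseAngle h : AddCircle π) + √(1 + h ^ 2) ⊗ₜ[ℤ] (apexAngle h : AddCircle π)

theorem nsmul_orthoschemeDehn_eq_zero_iff {h : ℝ} (hh : 0 < h) {n : ℕ} (hn : n ≠ 0) :
    n • orthoschemeDehn h = 0 ↔ h = 1 / √2 := by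
  -- Integer multiples are read as real scalar multiples through the first factor, so a nonzero n
  -- can be cancelled.
  rw [← Nat.cast_smul_eq_nsmul ℝ, smul_eq_zero, or_iff_right (by exact_mod_cast hn),
    orthoschemeDehn, tmul_baseAngle_add_tmul_apexAngle_eq_zero_iff hh]

theorem tmul_pi_div_two (x : ℝ) : x ⊗ₜ[ℤ] ((π / 2 : ℝ) : AddCircle π) = 0 :=
  tmul_eq_zero_of_mul_eq _ 2 1 (by norm_num) (by push_cast; ring)

theorem tmul_pi_div_four (x : ℝ) : x ⊗ₜ[ℤ] ((π / 4 : ℝ) : AddCircle π) = 0 :=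
  tmul_eq_zero_of_mul_eq _ 4 1 (by norm_num) (by push_cast; ring)

theorem tmul_two_mul (x θ : ℝ) : x ⊗ₜ[ℤ] ((2 * θ : ℝ) : AddCircle π) =
    2 • (x ⊗ₜ[ℤ] (θ : AddCircle π)) := by
  rw [two_mul, AddCircle.coe_add, TensorProduct.tmul_add, two_nsmul]

theorem dist_eq_sqrt_inner (p q : E3) : dist p q = √(inner ℝ (q - p) (q - p)) := by
  rw [dist_comm, dist_eq_norm, norm_eq_sqrt_real_inner]

section EdgeTerms

variable {h : ℝ} {p q r s : E3}

theorem edge_pi_div_two (hd : 0 < inner ℝ (q - p) (q - p)) (h : hingeGram p q r s = 0) :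
    dist p q ⊗ₜ[ℤ] (hingeAngle p q r s : AddCircle π) = 0 := by
  rw [hingeAngle_eq_pi_div_two hd h, tmul_pi_div_two]

theorem edge_pi_div_four (hC : 0 < hingeGram p q r s)
    (h : hingeGram p q r s ^ 2 * 2 = hingeGram p q r r * hingeGram p q s s) :
    dist p q ⊗ₜ[ℤ] (hingeAngle p q r s : AddCircle π) = 0 := by
  rw [hingeAngle_eq_pi_div_four hC h, tmul_pi_div_four]

theorem edge_baseAngle (k : ℕ) (hd : inner ℝ (q - p) (q - p) = (k : ℝ) ^ 2 / 2)
    (hC : 0 < hingeGram p q r s)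
    (hAB : hingeGram p q r s ^ 2 * (1 + 2 * h ^ 2) = hingeGram p q r r * hingeGram p q s s) :
    dist p q ⊗ₜ[ℤ] (hingeAngle p q r s : AddCircle π) =
      k • ((1 / √2) ⊗ₜ[ℤ] (baseAngle h : AddCircle π)) := by
  rw [hingeAngle_eq_baseAngle hC hAB, dist_eq_sqrt_inner, hd, Real.sqrt_div (sq_nonneg _),
    Real.sqrt_sq (Nat.cast_nonneg k), TensorProduct.smul_tmul', nsmul_eq_mul, mul_one_div]

theorem edge_apexAngle (hh : 0 < h) (hd : inner ℝ (q - p) (q - p) = 1 + h ^ 2)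
    (hC : 0 < hingeGram p q r s)
    (hAB : hingeGram p q r s ^ 2 * (1 + 2 * h ^ 2) =
      h ^ 2 * (hingeGram p q r r * hingeGram p q s s)) :
    dist p q ⊗ₜ[ℤ] (hingeAngle p q r s : AddCircle π) =
      √(1 + h ^ 2) ⊗ₜ[ℤ] (apexAngle h : AddCircle π) := by
  rw [hingeAngle_eq_apexAngle hh hC hAB, dist_eq_sqrt_inner, hd]

theorem edge_two_mul_apexAngle (hh : 0 < h) (hd : inner ℝ (q - p) (q - p) = 1 + h ^ 2)
    (hC : 0 < -hingeGram p q r s)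
    (hAB : (-hingeGram p q r s) ^ 2 * (1 + 2 * h ^ 2) ^ 2 =
      hingeGram p q r r * hingeGram p q s s) :
    dist p q ⊗ₜ[ℤ] (hingeAngle p q r s : AddCircle π) =
      2 • (√(1 + h ^ 2) ⊗ₜ[ℤ] (apexAngle h : AddCircle π)) := by
  rw [hingeAngle_eq_two_mul_apexAngle hh hC hAB, dist_eq_sqrt_inner, hd, tmul_two_mul]

end EdgeTerms

theorem add_six_congr {M : Type*} [Add M] {a b c d e f a' b' c' d' e' f' : M} (ha : a = a')
    (hb : b = b') (hc : c = c') (hd : d = d') (he : e = e') (hf : f = f') :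
    a + b + c + d + e + f = a' + b' + c' + d' + e' + f' := by
  rw [ha, hb, hc, hd, he, hf]

/-- All Gram determinants are functions of the inner products of the three consecutive edge vectors,
which the hypothesis prescribes; hence no coordinates are needed and every such orthoscheme is
covered. -/
theorem IsSchlafliOrthoscheme.dehn_eq {h : ℝ} (hh : 0 < h) {v : Fin 4 → E3}
    (hv : IsSchlafliOrthoscheme v (1 / √2) (1 / √2) h) :
    dehn (convexHull ℝ (Set.range v)) = orthoschemeDehn h := by
  obtain ⟨h12, h13, h23, d1, d2, d3⟩ := hv
  obtain ⟨x, hx⟩ : ∃ x, x = v 1 - v 0 := ⟨_, rfl⟩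
  obtain ⟨y, hy⟩ : ∃ y, y = v 2 - v 1 := ⟨_, rfl⟩
  obtain ⟨z, hz⟩ : ∃ z, z = v 3 - v 2 := ⟨_, rfl⟩
  have h2 : √2 ^ 2 = 2 := Real.sq_sqrt (by norm_num)
  have sq : ∀ {u w : E3} {a : ℝ}, dist u w = a → inner ℝ (w - u) (w - u) = a ^ 2 := by
    rintro u w _ rfl
    rw [real_inner_self_eq_norm_sq, dist_comm, dist_eq_norm]
  have hxx := sq d1
  have hyy := sq d2
  have hzz := sq d3
  rw [div_pow, h2, one_pow] at hxx hyy
  rw [← hx, ← hy] at h12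
  rw [← hx, ← hz] at h13
  rw [← hy, ← hz] at h23
  rw [← hx] at hxx
  rw [← hy] at hyy
  rw [← hz] at hzz
  have h21 : inner ℝ y x = 0 := by rw [real_inner_comm]; exact h12
  have h31 : inner ℝ z x = 0 := by rw [real_inner_comm]; exact h13
  have h32 : inner ℝ z y = 0 := by rw [real_inner_comm]; exact h23
  have v1 : v 1 = v 0 + x := by rw [hx]; abel
  have v2 : v 2 = v 0 + x + y := by rw [hx, hy]; abel
  have v3 : v 3 = v 0 + x + y + z := by rw [hx, hy, hz]; abel
  have e10 : v 1 - v 0 = x := hx.symm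
  have e21 : v 2 - v 1 = y := hy.symm
  have e32 : v 3 - v 2 = z := hz.symm
  have e20 : v 2 - v 0 = x + y := by rw [v2]; abel
  have e30 : v 3 - v 0 = x + y + z := by rw [v3]; abel
  have e31 : v 3 - v 1 = y + z := by rw [v3, v1]; abel
  have e01 : v 0 - v 1 = -x := by rw [v1]; abel
  have e12 : v 1 - v 2 = -y := by rw [v2, v1]; abel
  have e02 : v 0 - v 2 = -x - y := by rw [v2]; abel
  have hind : AffineIndependent ℝ v := by
    rw [affineIndependent_fin_four_iff]
    intro a b c d h0 h1
    have h1' : (b + c + d) • x + (c + d) • y + d • z = 0 := by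
      rw [v1, v2, v3, show a = -(b + c + d) by linarith] at h1
      rw [← h1]
      module
    have k1 := congrArg (inner ℝ x) h1'
    have k2 := congrArg (inner ℝ y) h1'
    have k3 := congrArg (inner ℝ z) h1'
    simp only [inner_add_right, inner_smul_right, h12, h13, h23, h21, h31, h32, hxx, hyy, hzz,
      inner_zero_right, mul_zero, add_zero, zero_add] at k1 k2 k3
    have hd : d = 0 := by
      have : h ^ 2 ≠ 0 := by positivity
      exact (mul_eq_zero.1 k3).resolve_right this
    refine ⟨?_, ?_, ?_, hd⟩ <;> linarith
  refine (dehn_tetrahedron hind).trans ((add_six_congr (edge_baseAngle (h := h) 1 ?_ ?_ ?_)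
    (edge_pi_div_two ?_ ?_) (edge_apexAngle hh ?_ ?_ ?_) (edge_pi_div_two ?_ ?_)
    (edge_pi_div_two ?_ ?_) (edge_pi_div_four ?_ ?_)).trans ?_)
  case refine_15 => rw [orthoschemeDehn]; module
  all_goals
    simp only [hingeGram, e10, e21, e32, e20, e30, e31, e01, e12, e02, inner_add_left,
      inner_add_right, inner_neg_left, inner_neg_right, inner_sub_left, inner_sub_right, h12, h13,
      h23, h21, h31, h32, hxx, hyy, hzz]
    first | (ring_nf; done) | (ring_nf; positivity)

end

/-! ### Dehn invariants of the six polytopes -/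

noncomputable section

open Real

theorem add_eight_congr {M : Type*} [Add M] {a b c d e f g i a' b' c' d' e' f' g' i' : M}
    (ha : a = a') (hb : b = b') (hc : c = c') (hd : d = d') (he : e = e') (hf : f = f')
    (hg : g = g') (hi : i = i') :
    a + b + c + d + e + f + g + i = a' + b' + c' + d' + e' + f' + g' + i' := by
  rw [ha, hb, hc, hd, he, hf, hg, hi]

theorem range_fin_four (a b c d : E3) : Set.range ![a, b, c, d] = {a, b, c, d} := by
  simp only [Matrix.range_cons, Matrix.range_empty, Set.union_empty, Set.singleton_union]

theorem range_fin_five (a b c d e : E3) : Set.range ![a, b, c, d, e] = {a, b, c, d, e} := by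
  simp only [Matrix.range_cons, Matrix.range_empty, Set.union_empty, Set.singleton_union]

/-- The Dehn invariant of the pyramid with base `a b c d` and apex `s`. -/
theorem dehn_pyramid_mk {a b c d s : E3} (hpar : a + c = b + d)
    (hv : AffineIndependent ℝ ![a, b, d, s]) :
    dehn (convexHull ℝ {a, b, c, d, s}) =
      dist a b ⊗ₜ[ℤ] (hingeAngle a b d s : AddCircle π) +
      dist b c ⊗ₜ[ℤ] (hingeAngle b c a s : AddCircle π) +
      dist c d ⊗ₜ[ℤ] (hingeAngle c d b s : AddCircle π) +
      dist d a ⊗ₜ[ℤ] (hingeAngle d a c s : AddCircle π) +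
      dist a s ⊗ₜ[ℤ] (hingeAngle a s b d : AddCircle π) +
      dist b s ⊗ₜ[ℤ] (hingeAngle b s a c : AddCircle π) +
      dist c s ⊗ₜ[ℤ] (hingeAngle c s b d : AddCircle π) +
      dist d s ⊗ₜ[ℤ] (hingeAngle d s c a : AddCircle π) := by
  rw [← range_fin_five]
  exact dehn_pyramid (v := ![a, b, c, d, s]) hpar hv

theorem pow_four_eq_one_iff {z : ℂ} :
    z ^ 4 = 1 ↔ z = 1 ∨ z = Complex.I ∨ z = -1 ∨ z = -Complex.I := by
  constructor
  · intro h
    have : (z - 1) * ((z - Complex.I) * ((z + 1) * (z + Complex.I))) = 0 := by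
      linear_combination h - (z ^ 2 - 1) * Complex.I_sq
    simp only [mul_eq_zero, sub_eq_zero, add_eq_zero_iff_eq_neg] at this
    exact this
  · rintro (rfl | rfl | rfl | rfl) <;> norm_num

theorem T1_eq (h : ℝ) : T1 h = convexHull ℝ
    {!₂[1, 0, 0], !₂[0, 1, 0], !₂[-1, 0, 0], !₂[0, -1, 0], !₂[0, 0, h]} := by
  rw [T1, symmetricPyramid]
  congr 1
  ext x
  simp only [pow_four_eq_one_iff, Set.mem_union, Set.mem_ofPred_eq, Set.mem_insert_iff,
    Set.mem_singleton_iff, or_and_right, exists_or, exists_eq_left]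
  simp only [Complex.one_re, Complex.one_im, Complex.I_re, Complex.I_im, Complex.neg_re,
    Complex.neg_im, neg_zero, or_assoc]

section Values

variable {h : ℝ}

theorem affineIndependent_mk {p q r s : E3}
    (H : ∀ a b c d : ℝ, a + b + c + d = 0 →
      (∀ i, a * p i + b * q i + c * r i + d * s i = 0) → a = 0 ∧ b = 0 ∧ c = 0 ∧ d = 0) :
    AffineIndependent ℝ ![p, q, r, s] := by
  rw [affineIndependent_fin_four_iff]
  intro a b c d h0 h1
  exact H a b c d h0 fun i => by simpa using congrArg (· i) h1

theorem dehn_T3 (hh : 0 < h) : dehn (T3 h) = 4 • orthoschemeDehn h := by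
  have hind : AffineIndependent ℝ (![!₂[1, 0, 0], !₂[0, 1, 0], !₂[-1, 0, 0], !₂[0, 0, h]] :
      Fin 4 → E3) := by
    refine affineIndependent_mk fun a b c d h0 H => ?_
    have k0 := H 0
    have k1 := H 1
    have k2 := H 2
    simp [hh.ne'] at k0 k1 k2
    refine ⟨?_, ?_, ?_, ?_⟩ <;> linarith
  rw [T3, ← range_fin_four]
  -- The numeral in `edge_baseAngle` is the length in units of 1/√2: a full side of the square base
  -- counts 2, a half side 1.
  refine (dehn_tetrahedron hind).trans ((add_six_congr (edge_baseAngle (h := h) 2 ?_ ?_ ?_)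
    (edge_pi_div_two ?_ ?_) (edge_apexAngle hh ?_ ?_ ?_) (edge_baseAngle (h := h) 2 ?_ ?_ ?_)
    (edge_two_mul_apexAngle hh ?_ ?_ ?_) (edge_apexAngle hh ?_ ?_ ?_)).trans ?_)
  case refine_18 => rw [orthoschemeDehn]; module
  all_goals
    simp only [hingeGram, Matrix.cons_val, inner_sub_sub_mk]
    first | (ring_nf; done) | (ring_nf; positivity)

theorem dehn_T5 (hh : 0 < h) : dehn (T5 h) = 2 • orthoschemeDehn h := by
  have hind : AffineIndependent ℝ (![!₂[0, 0, 0], !₂[1, 0, 0], !₂[0, 1, 0], !₂[0, 0, h]] :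
      Fin 4 → E3) := by
    refine affineIndependent_mk fun a b c d h0 H => ?_
    have k0 := H 0
    have k1 := H 1
    have k2 := H 2
    simp [hh.ne'] at k0 k1 k2
    refine ⟨?_, ?_, ?_, ?_⟩ <;> linarith
  rw [T5, ← range_fin_four]
  refine (dehn_tetrahedron hind).trans ((add_six_congr (edge_pi_div_two ?_ ?_)
    (edge_pi_div_two ?_ ?_) (edge_pi_div_two ?_ ?_) (edge_baseAngle (h := h) 2 ?_ ?_ ?_)
    (edge_apexAngle hh ?_ ?_ ?_) (edge_apexAngle hh ?_ ?_ ?_)).trans ?_)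
  case refine_16 => rw [orthoschemeDehn]; module
  all_goals
    simp only [hingeGram, Matrix.cons_val, inner_sub_sub_mk]
    first | (ring_nf; done) | (ring_nf; positivity)

theorem dehn_T1 (hh : 0 < h) : dehn (T1 h) = 8 • orthoschemeDehn h := by
  have hind : AffineIndependent ℝ (![!₂[1, 0, 0], !₂[0, 1, 0], !₂[0, -1, 0], !₂[0, 0, h]] :
      Fin 4 → E3) := by
    refine affineIndependent_mk fun a b c d h0 H => ?_
    have k0 := H 0
    have k1 := H 1
    have k2 := H 2
    simp [hh.ne'] at k0 k1 k2
    refine ⟨?_, ?_, ?_, ?_⟩ <;> linarith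
  rw [T1_eq]
  refine (dehn_pyramid_mk ?_ hind).trans ((add_eight_congr (edge_baseAngle (h := h) 2 ?_ ?_ ?_)
    (edge_baseAngle (h := h) 2 ?_ ?_ ?_) (edge_baseAngle (h := h) 2 ?_ ?_ ?_)
    (edge_baseAngle (h := h) 2 ?_ ?_ ?_) (edge_two_mul_apexAngle hh ?_ ?_ ?_)
    (edge_two_mul_apexAngle hh ?_ ?_ ?_) (edge_two_mul_apexAngle hh ?_ ?_ ?_)
    (edge_two_mul_apexAngle hh ?_ ?_ ?_)).trans ?_)
  case refine_1 => ext i; fin_cases i <;> simp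
  case refine_26 => rw [orthoschemeDehn]; module
  all_goals
    simp only [hingeGram, inner_sub_sub_mk]
    first | (ring_nf; done) | (ring_nf; positivity)

theorem dehn_T2 (hh : 0 < h) : dehn (T2 h) = 4 • orthoschemeDehn h := by
  have hind : AffineIndependent ℝ
      (![!₂[1, 0, 0], !₂[0, 1, 0], !₂[1 / 2, -1 / 2, 0], !₂[0, 0, h]] : Fin 4 → E3) := by
    refine affineIndependent_mk fun a b c d h0 H => ?_
    have k0 := H 0
    have k1 := H 1
    have k2 := H 2
    simp [hh.ne'] at k0 k1 k2
    refine ⟨?_, ?_, ?_, ?_⟩ <;> linarith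
  rw [T2]
  refine (dehn_pyramid_mk ?_ hind).trans ((add_eight_congr (edge_baseAngle (h := h) 2 ?_ ?_ ?_)
    (edge_baseAngle (h := h) 1 ?_ ?_ ?_) (edge_pi_div_two ?_ ?_)
    (edge_baseAngle (h := h) 1 ?_ ?_ ?_) (edge_two_mul_apexAngle hh ?_ ?_ ?_)
    (edge_two_mul_apexAngle hh ?_ ?_ ?_) (edge_pi_div_two ?_ ?_) (edge_pi_div_two ?_ ?_)).trans ?_)
  case refine_1 => ext i; fin_cases i <;> norm_num
  case refine_23 => rw [orthoschemeDehn]; module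
  all_goals
    simp only [hingeGram, inner_sub_sub_mk]
    first | (ring_nf; done) | (ring_nf; positivity)

theorem dehn_T4 (hh : 0 < h) : dehn (T4 h) = 2 • orthoschemeDehn h := by
  have hind : AffineIndependent ℝ
      (![!₂[0, 0, 0], !₂[1 / 2, 1 / 2, 0], !₂[1 / 2, -1 / 2, 0], !₂[0, 0, h]] : Fin 4 → E3) := by
    refine affineIndependent_mk fun a b c d h0 H => ?_
    have k0 := H 0
    have k1 := H 1
    have k2 := H 2
    simp [hh.ne'] at k0 k1 k2
    refine ⟨?_, ?_, ?_, ?_⟩ <;> linarith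
  rw [T4]
  refine (dehn_pyramid_mk ?_ hind).trans ((add_eight_congr (edge_pi_div_two ?_ ?_)
    (edge_baseAngle (h := h) 1 ?_ ?_ ?_) (edge_baseAngle (h := h) 1 ?_ ?_ ?_)
    (edge_pi_div_two ?_ ?_) (edge_pi_div_two ?_ ?_) (edge_pi_div_two ?_ ?_)
    (edge_two_mul_apexAngle hh ?_ ?_ ?_) (edge_pi_div_two ?_ ?_)).trans ?_)
  case refine_1 => ext i; fin_cases i <;> norm_num
  case refine_21 => rw [orthoschemeDehn]; module
  all_goals
    simp only [hingeGram, inner_sub_sub_mk]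
    first | (ring_nf; done) | (ring_nf; positivity)

/-- The orthogonal path is A, M, O, S, so the vertices are reordered from the definition of `T6`. -/
theorem T6_orthoscheme (hh : 0 < h) :
    IsSchlafliOrthoscheme ![!₂[1, 0, 0], !₂[1 / 2, 1 / 2, 0], !₂[0, 0, 0], !₂[0, 0, h]]
      (1 / √2) (1 / √2) h ∧
    T6 h = convexHull ℝ
      (Set.range ![!₂[1, 0, 0], !₂[1 / 2, 1 / 2, 0], !₂[0, 0, 0], !₂[0, 0, h]]) := by
  have h2 : 1 / √2 = √(1 / 2) := by rw [Real.sqrt_div zero_le_one, Real.sqrt_one]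
  constructor
  · rw [IsSchlafliOrthoscheme, h2]
    simp only [Matrix.cons_val, dist_eq_sqrt_inner, inner_sub_sub_mk]
    refine ⟨by norm_num, by norm_num, by norm_num, by norm_num, by norm_num, ?_⟩
    rw [show ((0 : ℝ) - 0) * (0 - 0) + (0 - 0) * (0 - 0) + (h - 0) * (h - 0) = h ^ 2 by ring,
      Real.sqrt_sq hh.le]
  · rw [T6, range_fin_four]
    congr 1
    ext x
    simp only [Set.mem_insert_iff, Set.mem_singleton_iff]
    tauto

end Values

end

/-! ### The symmetric cuts -/

noncomputable section

open Real

theorem affine_le_of_mem_convexHull {s : Set E3} (a b c k : ℝ)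
    (hs : ∀ x ∈ s, a * x 0 + b * x 1 + c * x 2 ≤ k) {x : E3} (hx : x ∈ convexHull ℝ s) :
    a * x 0 + b * x 1 + c * x 2 ≤ k := by
  refine convexHull_min (t := {x : E3 | a * x 0 + b * x 1 + c * x 2 ≤ k}) hs ?_ hx
  refine convex_halfSpace_le ⟨fun x y => ?_, fun t x => ?_⟩ k
  · simp only [PiLp.add_apply]; ring
  · simp only [PiLp.smul_apply, smul_eq_mul]; ring

theorem inner_mk_zero (a b : ℝ) (x : E3) : inner ℝ (!₂[a, b, 0] : E3) x = a * x 0 + b * x 1 := by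
  simp [PiLp.inner_apply, Fin.sum_univ_three]
  ring

theorem mem_convexHull_four {p q r s x : E3} (a b c d : ℝ) (ha : 0 ≤ a) (hb : 0 ≤ b) (hc : 0 ≤ c)
    (hd : 0 ≤ d) (hsum : a + b + c + d = 1)
    (hx : ∀ i, x i = a * p i + b * q i + c * r i + d * s i) : x ∈ convexHull ℝ {p, q, r, s} := by
  have h := (convex_convexHull ℝ ({p, q, r, s} : Set E3)).sum_mem (t := Finset.univ)
    (w := ![a, b, c, d]) (z := ![p, q, r, s]) (fun i _ => by fin_cases i <;> assumption)
    (by simpa [Fin.sum_univ_four] using hsum)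
    (fun i _ => subset_convexHull ℝ _ (by fin_cases i <;> simp))
  convert h
  ext i
  simp [Fin.sum_univ_four, hx i]

theorem mem_convexHull_five {p q r s t x : E3} (a b c d e : ℝ) (ha : 0 ≤ a) (hb : 0 ≤ b)
    (hc : 0 ≤ c) (hd : 0 ≤ d) (he : 0 ≤ e) (hsum : a + b + c + d + e = 1)
    (hx : ∀ i, x i = a * p i + b * q i + c * r i + d * s i + e * t i) :
    x ∈ convexHull ℝ {p, q, r, s, t} := by
  have h := (convex_convexHull ℝ ({p, q, r, s, t} : Set E3)).sum_mem (t := Finset.univ)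
    (w := ![a, b, c, d, e]) (z := ![p, q, r, s, t]) (fun i _ => by fin_cases i <;> assumption)
    (by simpa [Fin.sum_univ_five] using hsum)
    (fun i _ => subset_convexHull ℝ _ (by fin_cases i <;> simp))
  convert h
  ext i
  simp [Fin.sum_univ_five, hx i]

theorem reflection_mk (a b x y z : ℝ) :
    (ℝ ∙ (!₂[a, b, 0] : E3))ᗮ.reflection !₂[x, y, z] =
      !₂[x - 2 * (a * x + b * y) / (a ^ 2 + b ^ 2) * a,
        y - 2 * (a * x + b * y) / (a ^ 2 + b ^ 2) * b, z] := by
  have hn : ‖(!₂[a, b, 0] : E3)‖ ^ 2 = a ^ 2 + b ^ 2 := by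
    rw [← real_inner_self_eq_norm_sq, inner_mk_zero]
    simp only [Matrix.cons_val]
    ring
  rw [Submodule.reflection_orthogonal_apply, Submodule.reflection_singleton_apply, inner_mk_zero]
  simp only [RCLike.ofReal_real_eq_id, id, hn]
  ext i
  fin_cases i <;> simp <;> ring

/-- Reflection is a linear involution, so mapping generators to generators already makes the hull
invariant. Only `hst` needs work for each polytope: explicit convex weights for a point of the half.
-/
theorem isSymmetricCut_convexHull {a b : ℝ} (hab : a ^ 2 + b ^ 2 ≠ 0) {s t : Set E3}
    (hrefl : ∀ x ∈ s, (ℝ ∙ (!₂[a, b, 0] : E3))ᗮ.reflection x ∈ s)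
    (hts : t ⊆ convexHull ℝ s) (ht : ∀ x ∈ t, 0 ≤ a * x 0 + b * x 1)
    (hst : ∀ x ∈ convexHull ℝ s, 0 ≤ a * x 0 + b * x 1 → x ∈ convexHull ℝ t) :
    IsSymmetricCut (convexHull ℝ s) (convexHull ℝ t) := by
  refine ⟨!₂[a, b, 0], ?_, by simp, ?_, ?_⟩
  · intro h
    have h0 : a = 0 := by simpa using congrArg (· 0) h
    have h1 : b = 0 := by simpa using congrArg (· 1) h
    exact hab (by rw [h0, h1]; norm_num)
  · set σ := (ℝ ∙ (!₂[a, b, 0] : E3))ᗮ.reflection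
    have hσ : ∀ x, σ (σ x) = x := Submodule.reflection_reflection _
    have himg : σ '' s = s := by
      apply Set.Subset.antisymm
      · rintro _ ⟨x, hx, rfl⟩; exact hrefl x hx
      · intro x hx; exact ⟨σ x, hrefl x hx, hσ x⟩
    have := σ.toLinearEquiv.toLinearMap.image_convexHull s
    simp only [LinearEquiv.coe_coe, LinearIsometryEquiv.coe_toLinearEquiv, himg] at this
    exact this
  · apply Set.Subset.antisymm
    · intro x hx
      refine ⟨convexHull_min hts (convex_convexHull ℝ s) hx, ?_⟩
      have := affine_le_of_mem_convexHull (-a) (-b) 0 0 (fun y hy => by linarith [ht y hy]) hx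
      rw [Set.mem_ofPred_eq, inner_mk_zero]
      linarith
    · rintro x ⟨hx, hx'⟩
      rw [Set.mem_ofPred_eq, inner_mk_zero] at hx'
      exact hst x hx hx'

section Cuts

variable {h : ℝ}

theorem isSymmetricCut_T5_T6 (hh : 0 < h) : IsSymmetricCut (T5 h) (T6 h) := by
  refine isSymmetricCut_convexHull (a := 1) (b := -1) (by norm_num) ?_ ?_ ?_ ?_
  · rintro x (rfl | rfl | rfl | rfl) <;> rw [reflection_mk] <;> norm_num
  · rintro x (rfl | rfl | rfl | rfl)
    · exact subset_convexHull ℝ _ (by simp)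
    · refine mem_convexHull_four 0 (1 / 2) (1 / 2) 0 ?_ ?_ ?_ ?_ ?_ fun i => ?_
      on_goal 6 => fin_cases i
      all_goals norm_num
    · exact subset_convexHull ℝ _ (by simp)
    · exact subset_convexHull ℝ _ (by simp)
  · rintro x (rfl | rfl | rfl | rfl) <;> norm_num
  · intro x hx hx'
    -- Facet inequalities of the larger polytope; with the cutting half-space they are the
    -- nonnegativity of the barycentric coordinates below, where z = x₂/h is the weight of the apex
    -- S.
    have h1 := affine_le_of_mem_convexHull 1 1 (1 / h) 1
      (by rintro y (rfl | rfl | rfl | rfl) <;> simp [hh.ne']) hx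
    have h2 := affine_le_of_mem_convexHull 0 (-1) 0 0
      (by rintro y (rfl | rfl | rfl | rfl) <;> simp) hx
    have h3 := affine_le_of_mem_convexHull 0 0 (-(1 / h)) 0
      (by rintro y (rfl | rfl | rfl | rfl) <;> simp [hh.ne']) hx
    obtain ⟨z, hz⟩ : ∃ z, z = 1 / h * x 2 := ⟨_, rfl⟩
    have hz' : x 2 = z * h := by rw [hz]; field_simp
    refine mem_convexHull_four (1 - x 0 - x 1 - z) (2 * x 1) (x 0 - x 1) z ?_ ?_ ?_ ?_ ?_ fun i => ?_
    on_goal 6 => fin_cases i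
    all_goals try simp
    all_goals linarith

theorem isSymmetricCut_T4_T6 (hh : 0 < h) : IsSymmetricCut (T4 h) (T6 h) := by
  refine isSymmetricCut_convexHull (a := 0) (b := 1) (by norm_num) ?_ ?_ ?_ ?_
  · rintro x (rfl | rfl | rfl | rfl | rfl) <;> rw [reflection_mk] <;> norm_num
  · rintro x (rfl | rfl | rfl | rfl)
    · exact subset_convexHull ℝ _ (by simp)
    · exact subset_convexHull ℝ _ (by simp)
    · exact subset_convexHull ℝ _ (by simp)
    · exact subset_convexHull ℝ _ (by simp)
  · rintro x (rfl | rfl | rfl | rfl) <;> norm_num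
  · intro x hx hx'
    have h1 := affine_le_of_mem_convexHull 1 1 (1 / h) 1
      (by rintro y (rfl | rfl | rfl | rfl | rfl) <;> simp [hh.ne'] <;> norm_num) hx
    have h2 := affine_le_of_mem_convexHull (-1) 1 0 0
      (by rintro y (rfl | rfl | rfl | rfl | rfl) <;> simp <;> norm_num) hx
    have h3 := affine_le_of_mem_convexHull 0 0 (-(1 / h)) 0
      (by rintro y (rfl | rfl | rfl | rfl | rfl) <;> simp [hh.ne']) hx
    obtain ⟨z, hz⟩ : ∃ z, z = 1 / h * x 2 := ⟨_, rfl⟩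
    have hz' : x 2 = z * h := by rw [hz]; field_simp
    refine mem_convexHull_four (1 - x 0 - x 1 - z) (2 * x 1) (x 0 - x 1) z
      ?_ ?_ ?_ ?_ ?_ fun i => ?_
    on_goal 6 => fin_cases i
    all_goals try simp
    all_goals linarith

theorem isSymmetricCut_T3_T5 (hh : 0 < h) : IsSymmetricCut (T3 h) (T5 h) := by
  refine isSymmetricCut_convexHull (a := 1) (b := 0) (by norm_num) ?_ ?_ ?_ ?_
  · rintro x (rfl | rfl | rfl | rfl) <;> rw [reflection_mk] <;> norm_num
  · rintro x (rfl | rfl | rfl | rfl)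
    · refine mem_convexHull_four (1 / 2) 0 (1 / 2) 0 ?_ ?_ ?_ ?_ ?_ fun i => ?_
      on_goal 6 => fin_cases i
      all_goals norm_num
    · exact subset_convexHull ℝ _ (by simp)
    · exact subset_convexHull ℝ _ (by simp)
    · exact subset_convexHull ℝ _ (by simp)
  · rintro x (rfl | rfl | rfl | rfl) <;> norm_num
  · intro x hx hx'
    have h1 := affine_le_of_mem_convexHull 1 1 (1 / h) 1
      (by rintro y (rfl | rfl | rfl | rfl) <;> simp [hh.ne']) hx
    have h2 := affine_le_of_mem_convexHull 0 (-1) 0 0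
      (by rintro y (rfl | rfl | rfl | rfl) <;> simp) hx
    have h3 := affine_le_of_mem_convexHull 0 0 (-(1 / h)) 0
      (by rintro y (rfl | rfl | rfl | rfl) <;> simp [hh.ne']) hx
    obtain ⟨z, hz⟩ : ∃ z, z = 1 / h * x 2 := ⟨_, rfl⟩
    have hz' : x 2 = z * h := by rw [hz]; field_simp
    refine mem_convexHull_four (1 - x 0 - x 1 - z) (x 0) (x 1) z
      ?_ ?_ ?_ ?_ ?_ fun i => ?_
    on_goal 6 => fin_cases i
    all_goals try simp
    all_goals linarith

theorem isSymmetricCut_T1_T3 (hh : 0 < h) : IsSymmetricCut (T1 h) (T3 h) := by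
  rw [T1_eq]
  refine isSymmetricCut_convexHull (a := 0) (b := 1) (by norm_num) ?_ ?_ ?_ ?_
  · rintro x (rfl | rfl | rfl | rfl | rfl) <;> rw [reflection_mk] <;> norm_num
  · rintro x (rfl | rfl | rfl | rfl)
    · exact subset_convexHull ℝ _ (by simp)
    · exact subset_convexHull ℝ _ (by simp)
    · exact subset_convexHull ℝ _ (by simp)
    · exact subset_convexHull ℝ _ (by simp)
  · rintro x (rfl | rfl | rfl | rfl) <;> norm_num
  · intro x hx hx'
    have h1 := affine_le_of_mem_convexHull 1 1 (1 / h) 1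
      (by rintro y (rfl | rfl | rfl | rfl | rfl) <;> simp [hh.ne']) hx
    have h2 := affine_le_of_mem_convexHull (-1) 1 (1 / h) 1
      (by rintro y (rfl | rfl | rfl | rfl | rfl) <;> simp [hh.ne']) hx
    have h3 := affine_le_of_mem_convexHull 0 0 (-(1 / h)) 0
      (by rintro y (rfl | rfl | rfl | rfl | rfl) <;> simp [hh.ne']) hx
    obtain ⟨z, hz⟩ : ∃ z, z = 1 / h * x 2 := ⟨_, rfl⟩
    have hz' : x 2 = z * h := by rw [hz]; field_simp
    refine mem_convexHull_four ((1 - x 1 - z + x 0) / 2) (x 1) ((1 - x 1 - z - x 0) / 2) z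
      ?_ ?_ ?_ ?_ ?_ fun i => ?_
    on_goal 6 => fin_cases i
    all_goals try simp
    all_goals linarith

theorem isSymmetricCut_T2_T4 (hh : 0 < h) : IsSymmetricCut (T2 h) (T4 h) := by
  refine isSymmetricCut_convexHull (a := 1) (b := -1) (by norm_num) ?_ ?_ ?_ ?_
  · rintro x (rfl | rfl | rfl | rfl | rfl) <;> rw [reflection_mk] <;> norm_num
  · rintro x (rfl | rfl | rfl | rfl | rfl)
    · refine mem_convexHull_five 0 0 (1 / 2) (1 / 2) 0 ?_ ?_ ?_ ?_ ?_ ?_ fun i => ?_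
      on_goal 7 => fin_cases i
      all_goals norm_num
    · refine mem_convexHull_five (1 / 2) (1 / 2) 0 0 0 ?_ ?_ ?_ ?_ ?_ ?_ fun i => ?_
      on_goal 7 => fin_cases i
      all_goals norm_num
    · exact subset_convexHull ℝ _ (by simp)
    · exact subset_convexHull ℝ _ (by simp)
    · exact subset_convexHull ℝ _ (by simp)
  · rintro x (rfl | rfl | rfl | rfl | rfl) <;> norm_num
  · intro x hx hx'
    have h1 := affine_le_of_mem_convexHull 1 1 (1 / h) 1
      (by rintro y (rfl | rfl | rfl | rfl | rfl) <;> simp [hh.ne'] <;> norm_num) hx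
    have h2 := affine_le_of_mem_convexHull 1 (-1) (1 / h) 1
      (by rintro y (rfl | rfl | rfl | rfl | rfl) <;> simp [hh.ne'] <;> norm_num) hx
    have h3 := affine_le_of_mem_convexHull (-1) (-1) 0 0
      (by rintro y (rfl | rfl | rfl | rfl | rfl) <;> simp <;> norm_num) hx
    have h4 := affine_le_of_mem_convexHull 0 0 (-(1 / h)) 0
      (by rintro y (rfl | rfl | rfl | rfl | rfl) <;> simp [hh.ne']) hx
    obtain ⟨z, hz⟩ : ∃ z, z = 1 / h * x 2 := ⟨_, rfl⟩
    have hz' : x 2 = z * h := by rw [hz]; field_simp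
    -- Five vertices do not give unique weights, so the square base is split along its diagonal OA
    -- and one vertex gets weight 0.
    rcases le_total (x 0 + x 1) (x 0 - x 1) with hc | hc
    · refine mem_convexHull_five (1 - z - (x 0 - x 1)) 0 (x 0 + x 1) (-2 * x 1) z
        ?_ ?_ ?_ ?_ ?_ ?_ fun i => ?_
      on_goal 7 => fin_cases i
      all_goals try simp
      all_goals linarith
    · refine mem_convexHull_five (1 - z - (x 0 + x 1)) (2 * x 1) (x 0 - x 1) 0 z
        ?_ ?_ ?_ ?_ ?_ ?_ fun i => ?_
      on_goal 7 => fin_cases i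
      all_goals try simp
      all_goals linarith

theorem isSymmetricCut_T1_T2 (hh : 0 < h) : IsSymmetricCut (T1 h) (T2 h) := by
  rw [T1_eq]
  refine isSymmetricCut_convexHull (a := 1) (b := 1) (by norm_num) ?_ ?_ ?_ ?_
  · rintro x (rfl | rfl | rfl | rfl | rfl) <;> rw [reflection_mk] <;> norm_num
  · rintro x (rfl | rfl | rfl | rfl | rfl)
    · exact subset_convexHull ℝ _ (by simp)
    · exact subset_convexHull ℝ _ (by simp)
    · refine mem_convexHull_five 0 (1 / 2) (1 / 2) 0 0 ?_ ?_ ?_ ?_ ?_ ?_ fun i => ?_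
      on_goal 7 => fin_cases i
      all_goals norm_num
    · refine mem_convexHull_five (1 / 2) 0 0 (1 / 2) 0 ?_ ?_ ?_ ?_ ?_ ?_ fun i => ?_
      on_goal 7 => fin_cases i
      all_goals norm_num
    · exact subset_convexHull ℝ _ (by simp)
  · rintro x (rfl | rfl | rfl | rfl | rfl) <;> norm_num
  · intro x hx hx'
    have h1 := affine_le_of_mem_convexHull 1 1 (1 / h) 1
      (by rintro y (rfl | rfl | rfl | rfl | rfl) <;> simp [hh.ne']) hx
    have h2 := affine_le_of_mem_convexHull 1 (-1) (1 / h) 1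
      (by rintro y (rfl | rfl | rfl | rfl | rfl) <;> simp [hh.ne']) hx
    have h3 := affine_le_of_mem_convexHull (-1) 1 (1 / h) 1
      (by rintro y (rfl | rfl | rfl | rfl | rfl) <;> simp [hh.ne']) hx
    have h4 := affine_le_of_mem_convexHull 0 0 (-(1 / h)) 0
      (by rintro y (rfl | rfl | rfl | rfl | rfl) <;> simp [hh.ne']) hx
    obtain ⟨z, hz⟩ : ∃ z, z = 1 / h * x 2 := ⟨_, rfl⟩
    have hz' : x 2 = z * h := by rw [hz]; field_simp
    -- The rectangular base, scaled by 1 - z at height zh, is split along its diagonal AN.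
    rcases le_total (x 0 + x 1) ((x 0 - x 1 + (1 - z)) / 2) with hc | hc
    · refine mem_convexHull_five (x 0 + x 1) 0 (1 - z - (x 0 - x 1 + (1 - z)) / 2) ((x 0 - x 1 + (1 - z)) / 2 - (x 0 + x 1)) z
        ?_ ?_ ?_ ?_ ?_ ?_ fun i => ?_
      on_goal 7 => fin_cases i
      all_goals try simp
      all_goals linarith
    · refine mem_convexHull_five ((x 0 - x 1 + (1 - z)) / 2) (x 0 + x 1 - (x 0 - x 1 + (1 - z)) / 2) (1 - z - (x 0 + x 1)) 0 z
        ?_ ?_ ?_ ?_ ?_ ?_ fun i => ?_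
      on_goal 7 => fin_cases i
      all_goals try simp
      all_goals linarith

end Cuts

end

theorem mainTheorem5 (h : ℝ) (hpos : 0 < h) :
    (IsSymmetricCut (T1 h) (T2 h) ∧ IsSymmetricCut (T1 h) (T3 h) ∧
      IsSymmetricCut (T2 h) (T4 h) ∧ IsSymmetricCut (T3 h) (T5 h) ∧
      IsSymmetricCut (T4 h) (T6 h) ∧ IsSymmetricCut (T5 h) (T6 h)) ∧
    ((dehn (T1 h) = 0 ↔ h = 1 / √2) ∧ (dehn (T2 h) = 0 ↔ h = 1 / √2) ∧
      (dehn (T3 h) = 0 ↔ h = 1 / √2) ∧ (dehn (T4 h) = 0 ↔ h = 1 / √2) ∧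
      (dehn (T5 h) = 0 ↔ h = 1 / √2) ∧ (dehn (T6 h) = 0 ↔ h = 1 / √2)) ∧
    (∃ v : Fin 4 → E3, IsSchlafliOrthoscheme v (1 / √2) (1 / √2) h ∧
      T6 h = convexHull ℝ (Set.range v)) ∧
    (∀ v : Fin 4 → E3, IsSchlafliOrthoscheme v (1 / √2) (1 / √2) h →
      (dehn (convexHull ℝ (Set.range v)) = 0 ↔ h = 1 / √2)) := by
  have orth : ∀ v : Fin 4 → E3, IsSchlafliOrthoscheme v (1 / √2) (1 / √2) h →
      (dehn (convexHull ℝ (Set.range v)) = 0 ↔ h = 1 / √2) := fun v hv => by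
    rw [hv.dehn_eq hpos, ← one_nsmul (orthoschemeDehn h)]
    exact nsmul_orthoschemeDehn_eq_zero_iff hpos one_ne_zero
  obtain ⟨h6, hT6⟩ := T6_orthoscheme hpos
  refine ⟨⟨isSymmetricCut_T1_T2 hpos, isSymmetricCut_T1_T3 hpos, isSymmetricCut_T2_T4 hpos,
    isSymmetricCut_T3_T5 hpos, isSymmetricCut_T4_T6 hpos, isSymmetricCut_T5_T6 hpos⟩,
    ⟨?_, ?_, ?_, ?_, ?_, ?_⟩, ⟨_, h6, hT6⟩, orth⟩
  · rw [dehn_T1 hpos]; exact nsmul_orthoschemeDehn_eq_zero_iff hpos (by norm_num)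
  · rw [dehn_T2 hpos]; exact nsmul_orthoschemeDehn_eq_zero_iff hpos (by norm_num)
  · rw [dehn_T3 hpos]; exact nsmul_orthoschemeDehn_eq_zero_iff hpos (by norm_num)
  · rw [dehn_T4 hpos]; exact nsmul_orthoschemeDehn_eq_zero_iff hpos (by norm_num)
  · rw [dehn_T5 hpos]; exact nsmul_orthoschemeDehn_eq_zero_iff hpos (by norm_num)
  · rw [hT6]; exact orth _ h6
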